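/- **Proposition.** Let $\mathbf p=(p_1,p_2,p_3)$ be a probability vector with all $p_i>0$, $|\mathbf p|=(p_1^2+p_2^2+p_3^2)^{1/2}$, and let $\Omega=\{v\in\mathbb R^3: |v|=1,\ |v_i|=p_i/|\mathbf p|\ (i=1,2,3)\}$. Let $\vartheta_i$ change the sign of the $i$-th coordinate, and for $v\in\Omega$ put $\Omega_v=\{\vartheta_1(v),\vartheta_2(v),\vartheta_3(v)\}$. For $r>0$ let $\mathcal Q_r=[-r/2,r/2]^3$, and for $w=\vartheta_k(v)$ let $B(v,w)=\{b\in\partial\mathcal Q_r: b_k=-\tfrac{v_k}{|v_k|}\tfrac r2\}$. Fix $v_0\in\Omega$. The Markovian flight process is built from the following random variables. The velocities $(u_n)_{n\ge1}$ form a Markov chain with $u_1=v_0$ that jumps from $v$ to $\vartheta_i(v)$ with probability $p_i$; $u_0\in\Omega_{v_0}$ (fixed, or random and independent of all that follows time $0$); $\xi_1,\xi_2,\dots$ are i.i.d. $\mathrm{EXP}(1)$, independent of $(u_n)$; given all these, the $\beta_k$ ($k\ge0$) are independent, $\beta_k$ being uniform on the square $-B(u_k,u_{k+1})$. Put $\tau_n=\sum_{i=1}^n\xi_i$,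 $Y_n=\sum_{i=1}^n\xi_iu_i$, $\nu_t=\max\{n:\tau_n\le t\}$, $Y(t)=Y_{\nu_t}+(t-\tau_{\nu_t})u_{\nu_t+1}$, and let $Y'_k=Y_k+\beta_k$ be the virtual scatterers. The process is cut into i.i.d. excursions at the successive returns of the velocity to $v_0$: $\Gamma_0=0$, $\Gamma_{j+1}=\min\{i>\Gamma_j+1: u_{i+1}=v_0\}$, $\Theta_j=\tau_{\Gamma_j}$. For $j\ge1$ define the events of inter-excursion virtual shadowing and virtual recollision $$\widehat W_j=\big\{\exists\, 0<t<\Theta_{j-1},\ \Gamma_{j-1}<k\le\Gamma_j:\ Y(t)-Y'_k\in\mathcal Q_r\big\},$$ $$\widetilde W_j=\big\{\exists\, 0\le k<\Gamma_{j-1},\ \Theta_{j-1}<t<\Theta_j:\ Y'_k-Y(t)\in\mathcal Q_r\big\}.$$ (i) There is a constant $C>0$, depending only on $\mathbf p$ and $v_0$, such that for all $r>0$ and all $j\ge1$ $$\mathbf P(\widehat W_j)\le Cr,\qquad \mathbf P(\widetilde W_j)\le Cr .$$ (ii) There are no virtual mismatches up to times $o(r^{-1})$: if $T=T(r)$ satisfies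 $rT(r)\to0$ as $r\to0^+$, then, as $r\to0^+$, the probability that there are $k\ge0$ with $\tau_k\le T$ and $0<t\le T$ such that $Y(t)-Y'_k\in\mathcal Q_r$ and either $k\ge 1$ and $t\le\tau_{k-1}$ (collision $k$ is virtually shadowed) or $t\ge\tau_{k+1}$ (the path virtually recollides with scatterer $k$) tends to $0$. -/

import Mathlib

open MeasureTheory ProbabilityTheory Filter Topology
open scoped ENNReal

universe u

noncomputable section

namespace WindTree

/-- Physical space `ℝ³` with its Euclidean norm. -/
abbrev Space : Type := EuclideanSpace ℝ (Fin 3)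

/-- `p` is a probability vector with positive entries. -/
def IsWeight (p : Fin 3 → ℝ) : Prop := (∀ i, 0 < p i) ∧ ∑ i, p i = 1

/-- The velocity space `Ω`: unit vectors `v` with `|v_i| = p_i / |p|`. -/
def velocities (p : Fin 3 → ℝ) : Set Space :=
  {v | v ∈ Metric.sphere (0 : Space) 1 ∧ ∀ i, |v i| = p i / Real.sqrt (∑ j, p j ^ 2)}

/-- The reflection `ϑ_i`, changing the sign of the `i`-th coordinate. -/
def flip (i : Fin 3) (v : Space) : Space :=
  WithLp.toLp 2 (fun j => if j = i then -v j else v j)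

/-- `Ω_v`: the velocities accessible from `v` by one collision. -/
def accessible (p : Fin 3 → ℝ) (v : Space) : Set Space :=
  {w | w ∈ velocities p ∧ ∃ i, w = flip i v}

/-- The jump law `m_v`, which selects `ϑ_i(v)` with probability `p_i`. -/
def jump (p : Fin 3 → ℝ) (v : Space) : Measure Space :=
  ∑ i, ENNReal.ofReal (p i) • Measure.dirac (flip i v)

/-- The closed cube `Q_r` of side length `r`, centred at the origin, parallel to the axes. -/
def cube (r : ℝ) : Set Space := {x | ∀ i, |x i| ≤ r / 2}

/-- `B(v, w)`: the face of `∂Q_r` hit by a particle whose velocity jumps from `v` to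
`w = ϑ_k(v)`. -/
def face (r : ℝ) (v w : Space) : Set Space :=
  {b | b ∈ frontier (cube r) ∧ ∃ k, w = flip k v ∧ b k = -(v k / |v k|) * (r / 2)}

/-- The uniform distribution on `-B(v, w)`: normalised surface (two-dimensional Hausdorff)
measure on the reflected face. -/
def impactLaw (r : ℝ) (v w : Space) : Measure Space :=
  ProbabilityTheory.cond (Measure.hausdorffMeasure 2) {b : Space | -b ∈ face r v w}

/-- The random data of a Markovian flight process, defined on a probability space `(S, P)`:
`u 1 = v₀`, the velocities `u 1, u 2, …` form a Markov chain with jump laws `m_v`, the initial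
velocity before the (virtual) collision at time `0` is some `u 0 ∈ Ω_{v₀}` (of any law), the flight
times `ξ 1, ξ 2, …` are i.i.d. standard exponential and independent of the velocities, and, given
all these, the `β k`, `k ≥ 0`, are independent and uniform on `-B(u k, u (k+1))`.
The value `ξ 0` is never used. -/
structure IsFlightData (p : Fin 3 → ℝ) (v₀ : Space) (r : ℝ) {S : Type u} [MeasurableSpace S]
    (P : Measure S) (u : ℕ → S → Space) (ξ : ℕ → S → ℝ) (β : ℕ → S → Space) : Prop where
  measurable_u : ∀ n, Measurable (u n)
  measurable_ξ : ∀ n, Measurable (ξ n)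
  measurable_β : ∀ n, Measurable (β n)
  u_zero : ∀ᵐ ω ∂P, u 0 ω ∈ accessible p v₀
  u_one : ∀ᵐ ω ∂P, u 1 ω = v₀
  law : ∀ (n : ℕ) (w : ℕ → Space) (A : ℕ → Set ℝ) (D : ℕ → Set Space),
    (∀ i, MeasurableSet (A i)) → (∀ i, MeasurableSet (D i)) →
    P {ω | (∀ i ∈ Finset.Icc 0 (n + 1), u i ω = w i) ∧
           (∀ i ∈ Finset.Icc 1 n, ξ i ω ∈ A i) ∧
           (∀ i ∈ Finset.Icc 0 n, β i ω ∈ D i)}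
      = P {ω | u 0 ω = w 0 ∧ u 1 ω = w 1} *
        (∏ i ∈ Finset.Icc 1 n, jump p (w i) {w (i + 1)}) *
        (∏ i ∈ Finset.Icc 1 n, expMeasure 1 (A i)) *
        ∏ i ∈ Finset.Icc 0 n, impactLaw r (w i) (w (i + 1)) (D i)

/-! The remaining definitions are pathwise: `u`, `ξ`, `β` are now sequences. -/

/-- Scattering times `τ_n = ξ_1 + ⋯ + ξ_n`. -/
def scatterTime (ξ : ℕ → ℝ) (n : ℕ) : ℝ := ∑ i ∈ Finset.Icc 1 n, ξ i

/-- The discrete flight process `Y_n = ξ_1 u_1 + ⋯ + ξ_n u_n`. -/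
def position (u : ℕ → Space) (ξ : ℕ → ℝ) (n : ℕ) : Space := ∑ i ∈ Finset.Icc 1 n, ξ i • u i

/-- `ν_t = max {n : τ_n ≤ t}`, the label of the last scattering before time `t`. -/
def lastScatter (ξ : ℕ → ℝ) (t : ℝ) : ℕ := sSup {n | scatterTime ξ n ≤ t}

/-- The continuous flight process `Y(t) = Y_{ν_t} + (t - τ_{ν_t}) u_{ν_t + 1}`. -/
def flight (u : ℕ → Space) (ξ : ℕ → ℝ) (t : ℝ) : Space :=
  position u ξ (lastScatter ξ t) +
    (t - scatterTime ξ (lastScatter ξ t)) • u (lastScatter ξ t + 1)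

/-- The virtual scatterers `Y'_k = Y_k + β_k`. -/
def scatterer (u : ℕ → Space) (ξ : ℕ → ℝ) (β : ℕ → Space) (k : ℕ) : Space :=
  position u ξ k + β k

/-- `Γ_j`: the label of the last flight of the `j`-th excursion. The excursions end at the
successive returns of the velocity to `v₀`: `Γ_0 = 0` and
`Γ_{j+1} = min {i > Γ_j + 1 : u_{i+1} = v₀}`. -/
def excursionEnd (v₀ : Space) (u : ℕ → Space) : ℕ → ℕ
  | 0 => 0
  | j + 1 => sInf {i | excursionEnd v₀ u j + 1 < i ∧ u (i + 1) = v₀}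

/-- `Θ_j`: the time at which the `j`-th excursion ends. -/
def excursionTime (v₀ : Space) (u : ℕ → Space) (ξ : ℕ → ℝ) (j : ℕ) : ℝ :=
  scatterTime ξ (excursionEnd v₀ u j)

/-- Inter-excursion virtual shadowing: some virtual scatterer of the `j`-th excursion is
met by the path of the earlier excursions. -/
def InterShadowing (r : ℝ) (v₀ : Space) (u : ℕ → Space) (ξ : ℕ → ℝ) (β : ℕ → Space)
    (j : ℕ) : Prop :=
  ∃ (t : ℝ) (k : ℕ), 0 < t ∧ t < excursionTime v₀ u ξ (j - 1) ∧
    excursionEnd v₀ u (j - 1) < k ∧ k ≤ excursionEnd v₀ u j ∧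
    flight u ξ t - scatterer u ξ β k ∈ cube r

/-- Inter-excursion virtual recollision: the path of the `j`-th excursion meets some
virtual scatterer of the earlier excursions. -/
def InterRecollision (r : ℝ) (v₀ : Space) (u : ℕ → Space) (ξ : ℕ → ℝ) (β : ℕ → Space)
    (j : ℕ) : Prop :=
  ∃ (t : ℝ) (k : ℕ), k < excursionEnd v₀ u (j - 1) ∧
    excursionTime v₀ u ξ (j - 1) < t ∧ t < excursionTime v₀ u ξ j ∧
    scatterer u ξ β k - flight u ξ t ∈ cube r

/-- A virtual mismatch of any kind (inter- or intra-excursion) up to time `T`: the scatterer of a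
collision `k` with `τ_k ≤ T` is met by the path at a time `t ≤ T` which lies either before the
flight that leads to collision `k` (shadowing) or after the flight that leaves it (recollision). -/
def MismatchUpTo (r : ℝ) (u : ℕ → Space) (ξ : ℕ → ℝ) (β : ℕ → Space) (T : ℝ) : Prop :=
  ∃ (t : ℝ) (k : ℕ), 0 < t ∧ t ≤ T ∧ scatterTime ξ k ≤ T ∧
    (t ≤ scatterTime ξ (k - 1) ∨ scatterTime ξ (k + 1) ≤ t) ∧
    flight u ξ t - scatterer u ξ β k ∈ cube r

end WindTree

end

/-!
A mismatch between a scatterer and a piece of the path forces the particle to return to within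
`O(r)` of an earlier point of its path: as the impact vectors `β k` lie in the cube of side `r`, a
collision `k` that is shadowed, or recollided with, during flight `c` means that the displacement
over the flights between `c` and `k`, prolonged by a part of flight `c`, lies in the cube of side
`2 r` (`FlightHit`).

*One hit.* Given the velocities, the flight times are independent standard exponential variables
(`IsFlightData.isExpSequence_cond`). Two successive flights are not parallel, so a hit forces a
single flight time into an interval of length `O(r)` (`measure_signHit_le_linear`). If the flights
between visit the three directions `ϑ_i v₀` at least `N ≥ 1` times each, the total times spent in
these directions are independent gamma variables with densities at most `N ^ (-1/2)` (by Stirling's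
formula). Since the vectors `ϑ_i v₀` are linearly independent, covering flight `c` by `O(1 / r)`
cubes of side `O(r)` gives the bound `O(r ^ 3) * N ^ (-3/2) * O(1 / r)`
(`measure_signHit_le_cubic`). So for `r ≤ 1` a hit has conditional probability at most
`K r ∑ k, (N_k + 1) ^ (-3/2)`, where `N_k` counts the flights in direction `ϑ_k v₀`
(`measure_signHit_le`).

*Summation.* The directions perform a random walk on `(ℤ/2)³` with independent steps. The expected
time between two visits to a point is bounded, so the expectation of `∑ n, g (N_k (n))` over the
length `n` of the run of flights is at most a constant times `∑ q, g q`
(`sum_wordSum_visits_le`). As `∑ q, (q + 1) ^ (-3/2) < ∞`, the hits of all runs of flights that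
begin with a given flight have total probability `O(r)`; at most `4 T + O(1)` flights take place up
to time `T`, with high probability, and the second assertion follows.

For the first assertion, the runs of flights are those which contain, or touch, the end `g` of
excursion `j - 1`. The event that the `(j - 1)`-st return occurs after exactly `g` steps and its
probability are invariant under reversal of the word of flips, so that the sum over all `g` of the
contributions of the last `n` flights of the past is at most that of the first `n` flights of a walk
started afresh (`tsum_wordSum_past_le`); this is summable in `n`, uniformly in `j`. The number of
flights after `g` is bounded by the length of one excursion, which has finite expectation.
-/

noncomputable section

namespace WindTree

/-! ### Sums of independent exponential variables -/

/-- The density `x ^ n / n! * e ^ (-x)` of a sum of `n + 1` independent standard exponential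
variables. -/
def erlangPDF (n : ℕ) (x : ℝ) : ℝ≥0∞ :=
  ENNReal.ofReal (if 0 ≤ x then x ^ n / n.factorial * Real.exp (-x) else 0)

lemma measurable_erlangPDF (n : ℕ) : Measurable (erlangPDF n) := by
  unfold erlangPDF
  refine ENNReal.measurable_ofReal.comp (Measurable.ite measurableSet_Ici ?_ measurable_const)
  fun_prop

lemma expMeasure_one_eq : expMeasure 1 = volume.withDensity (erlangPDF 0) := by
  unfold expMeasure gammaMeasure
  congr 1
  ext x
  change exponentialPDF 1 x = _
  rw [exponentialPDF_eq]
  simp [erlangPDF]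

lemma lconvolution_erlangPDF (n : ℕ) :
    (erlangPDF n) ⋆ₗ[volume] (erlangPDF 0) = erlangPDF (n + 1) := by
  ext x
  rw [lconvolution_def]
  have key : ∀ y : ℝ, erlangPDF n y * erlangPDF 0 (-y + x) =
      (Set.Icc 0 x).indicator
        (fun y => ENNReal.ofReal (Real.exp (-x) * (y ^ n / n.factorial))) y := by
    intro y
    by_cases h0 : 0 ≤ y
    · by_cases h1 : y ≤ x
      · have h2 : 0 ≤ -y + x := by linarith
        have h3 : y ∈ Set.Icc 0 x := ⟨h0, h1⟩
        rw [Set.indicator_of_mem h3]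
        simp only [erlangPDF, h0, h2, if_true]
        rw [← ENNReal.ofReal_mul (by positivity)]
        congr 1
        have : Real.exp (-x) = Real.exp (-y) * Real.exp (-(-y + x)) := by
          rw [← Real.exp_add]; congr 1; ring
        rw [this]
        simp
        ring
      · have h2 : ¬ 0 ≤ -y + x := by linarith
        have h3 : y ∉ Set.Icc 0 x := fun h => h1 h.2
        rw [Set.indicator_of_notMem h3]
        simp only [erlangPDF, h2, if_false, ENNReal.ofReal_zero, mul_zero]
    · have h3 : y ∉ Set.Icc 0 x := fun h => h0 h.1
      rw [Set.indicator_of_notMem h3]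
      simp only [erlangPDF, h0, if_false, ENNReal.ofReal_zero, zero_mul]
  simp_rw [key]
  rw [lintegral_indicator measurableSet_Icc]
  by_cases hx : 0 ≤ x
  · rw [← ofReal_integral_eq_lintegral_ofReal]
    · rw [integral_Icc_eq_integral_Ioc, ← intervalIntegral.integral_of_le hx]
      simp only [erlangPDF, hx, if_true]
      congr 1
      rw [intervalIntegral.integral_const_mul, intervalIntegral.integral_div, integral_pow,
        Nat.factorial_succ]
      push_cast
      have : (n.factorial : ℝ) ≠ 0 := by positivity
      have : (n : ℝ) + 1 ≠ 0 := by positivity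
      field_simp
      simp
    · apply Continuous.integrableOn_Icc
      fun_prop
    · refine (ae_restrict_iff' measurableSet_Icc).2 (Eventually.of_forall fun y hy => ?_)
      have := hy.1
      simp only [Pi.zero_apply]
      positivity
  · simp [erlangPDF, hx]

/-- Gamma densities flatten like the inverse square root of the number of summands; the mode
of `x ^ n * e ^ (-x)` is `x = n`, where Stirling's bound applies. -/
lemma erlangPDF_le (n : ℕ) (x : ℝ) : erlangPDF n x ≤ ENNReal.ofReal (1 / √(n + 1)) := by
  unfold erlangPDF
  apply ENNReal.ofReal_le_ofReal
  split_ifs with hx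
  swap
  · positivity
  rcases Nat.eq_zero_or_pos n with rfl | hn
  · simpa using hx
  have hn' : (1 : ℝ) ≤ n := by exact_mod_cast hn
  have hn0 : (0 : ℝ) < n := by linarith
  have h1 : x ^ n * Real.exp (-x) ≤ (n / Real.exp 1) ^ n := by
    have h2 : x / n ≤ Real.exp (x / n - 1) := by
      have := Real.add_one_le_exp (x / n - 1); linarith
    have h3 : (x / n) ^ n ≤ Real.exp (x / n - 1) ^ n := pow_le_pow_left₀ (by positivity) h2 n
    have h4 : Real.exp (x / n - 1) ^ n = Real.exp x / Real.exp 1 ^ n := by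
      rw [← Real.exp_nat_mul, ← Real.exp_nat_mul, ← Real.exp_sub]
      congr 1; field_simp
    rw [h4, div_pow, div_le_div_iff₀ (by positivity) (by positivity)] at h3
    rw [Real.exp_neg, div_pow, ← div_eq_mul_inv, div_le_div_iff₀ (by positivity) (by positivity)]
    linarith
  have h5 := Stirling.le_factorial_stirling n
  have h6 : √((n : ℝ) + 1) ≤ √(2 * Real.pi * n) := by
    apply Real.sqrt_le_sqrt
    nlinarith [Real.pi_gt_three]
  have h7 : √((n : ℝ) + 1) * (x ^ n * Real.exp (-x)) ≤ n.factorial :=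
    le_trans (mul_le_mul h6 h1 (by positivity) (by positivity)) h5
  rw [div_mul_eq_mul_div, div_le_div_iff₀ (by positivity) (by positivity)]
  linarith

lemma erlangPDF_le_exp (n : ℕ) (x : ℝ) :
    erlangPDF n x ≤ ENNReal.ofReal ((1 / 4) ^ n * Real.exp (3 * x)) := by
  unfold erlangPDF
  apply ENNReal.ofReal_le_ofReal
  split_ifs with hx
  swap
  · positivity
  have h := Real.pow_div_factorial_le_exp (4 * x) (by positivity) n
  have h2 : x ^ n / n.factorial ≤ (1 / 4) ^ n * Real.exp (4 * x) := by
    calc x ^ n / n.factorial = (1 / 4) ^ n * ((4 * x) ^ n / n.factorial) := by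
          rw [mul_pow, div_pow, one_pow]; field_simp
      _ ≤ _ := by gcongr
  calc x ^ n / n.factorial * Real.exp (-x)
      ≤ (1 / 4) ^ n * Real.exp (4 * x) * Real.exp (-x) := by gcongr
    _ = _ := by rw [mul_assoc, ← Real.exp_add]; congr 2; ring

section ExpSequence
variable {S : Type*} [MeasurableSpace S] {μ : Measure S} {η : ℕ → S → ℝ}

/-- A sequence of independent standard exponential random variables. -/
structure IsExpSequence (μ : Measure S) (η : ℕ → S → ℝ) : Prop where
  measurable : ∀ i, Measurable (η i)
  indep : iIndepFun η μ
  law : ∀ i, μ.map (η i) = expMeasure 1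

/-- The sum of the `η i`, `i ∈ I`. -/
abbrev blockSum (η : ℕ → S → ℝ) (I : Finset ℕ) (ω : S) : ℝ := ∑ i ∈ I, η i ω

lemma map_blockSum [IsProbabilityMeasure μ] (h : IsExpSequence μ η) (I : Finset ℕ) (n : ℕ)
    (hI : I.card = n + 1) : μ.map (blockSum η I) = volume.withDensity (erlangPDF n) := by
  induction n generalizing I with
  | zero =>
    obtain ⟨i, rfl⟩ := Finset.card_eq_one.1 hI
    rw [← expMeasure_one_eq, ← h.law i]
    congr 1
    ext ω
    simp [blockSum]
  | succ n ih =>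
    obtain ⟨i, J, hi, rfl, hJ⟩ := Finset.card_eq_succ.1 hI
    have e : blockSum η (insert i J) = blockSum η J + η i := by
      ext ω
      simp [blockSum, Finset.sum_insert hi, add_comm]
    have e2 : blockSum η J = ∑ j ∈ J, η j := by
      ext ω; simp [blockSum]
    have hind : IndepFun (blockSum η J) (η i) μ := by
      rw [e2]; exact h.indep.indepFun_finsetSum_of_notMem h.measurable hi
    have hm : Measurable (blockSum η J) := Finset.measurable_sum _ fun j _ => h.measurable j
    rw [e, hind.map_add_eq_map_conv_map hm (h.measurable i), ih J hJ, h.law i, expMeasure_one_eq,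
      conv_withDensity_eq_lconvolution (measurable_erlangPDF _) (measurable_erlangPDF _),
      lconvolution_erlangPDF]

end ExpSequence

/-! ### Anti-concentration with frozen data -/

section Sigma
variable {S : Type*} {η : ℕ → S → ℝ}

/-- The `σ`-algebra generated by the `η j`, `j ∈ J`. -/
abbrev sigmaOf (η : ℕ → S → ℝ) (J : Finset ℕ) : MeasurableSpace S :=
  ⨆ j ∈ (J : Set ℕ), MeasurableSpace.comap (η j) inferInstance

lemma measurable_sigmaOf {J : Finset ℕ} {j : ℕ} (hj : j ∈ J) : Measurable[sigmaOf η J] (η j) :=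
  (comap_measurable (η j)).mono
    (le_iSup₂ (f := fun j (_ : j ∈ (J : Set ℕ)) => MeasurableSpace.comap (η j) inferInstance)
      j (by exact_mod_cast hj)) le_rfl

lemma measurable_sum_sigmaOf {J F : Finset ℕ} (hF : F ⊆ J) (c : ℕ → ℝ) :
    Measurable[sigmaOf η J] (fun ω => ∑ i ∈ F, η i ω * c i) :=
  Finset.measurable_sum F fun _ hi => (measurable_sigmaOf (hF hi)).mul_const _

lemma measurable_blockSum_sigmaOf {J F : Finset ℕ} (hF : F ⊆ J) :
    Measurable[sigmaOf η J] (blockSum η F) :=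
  Finset.measurable_sum F fun _ hi => measurable_sigmaOf (hF hi)

end Sigma

section ExpSequence
variable {S : Type*} {m : MeasurableSpace S} [mS : MeasurableSpace S] {μ : Measure S}
  {η : ℕ → S → ℝ}

lemma measurable_blockSum (h : IsExpSequence μ η) (I : Finset ℕ) : Measurable (blockSum η I) :=
  Finset.measurable_sum _ fun j _ => h.measurable j

lemma IsExpSequence.sigmaOf_le (h : IsExpSequence μ η) (J : Finset ℕ) :
    sigmaOf η J ≤ mS :=
  iSup₂_le fun j _ => (h.measurable j).comap_le

lemma IsExpSequence.indep_sigmaOf (h : IsExpSequence μ η) {I J : Finset ℕ} (hIJ : Disjoint J I) :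
    Indep (sigmaOf η J) (sigmaOf η I) μ :=
  indep_iSup_of_disjoint (fun i => (h.measurable i).comap_le) h.indep
    (by exact_mod_cast hIJ)

lemma measure_blockSum_Icc_le [IsProbabilityMeasure μ] (h : IsExpSequence μ η) {I : Finset ℕ}
    (hI : 0 < I.card) (x δ : ℝ) :
    (μ.map (blockSum η I)) (Set.Icc x (x + δ)) ≤ ENNReal.ofReal (δ / √I.card) := by
  obtain ⟨n, hn⟩ : ∃ n, I.card = n + 1 := ⟨I.card - 1, by omega⟩
  rw [map_blockSum h I n hn, withDensity_apply _ measurableSet_Icc]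
  calc ∫⁻ y in Set.Icc x (x + δ), erlangPDF n y
      ≤ ∫⁻ _ in Set.Icc x (x + δ), ENNReal.ofReal (1 / √(n + 1)) :=
        lintegral_mono fun y => erlangPDF_le n y
    _ = ENNReal.ofReal (1 / √(n + 1)) * ENNReal.ofReal δ := by
        rw [setLIntegral_const, Real.volume_Icc]; simp
    _ = _ := by
        rw [← ENNReal.ofReal_mul (by positivity), hn]
        congr 1
        push_cast
        ring

/-- Freezing: if `G` is independent of a `σ`-algebra `m` to which `E` and `X` belong, a uniform
bound for `G` to fall in an interval of length `δ` survives when the interval depends on `X`. -/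
lemma measure_inter_abs_le [IsProbabilityMeasure μ] (hm : m ≤ mS) {G : S → ℝ} (hG : Measurable G)
    (hind : Indep m (MeasurableSpace.comap G inferInstance) μ) {E : Set S}
    (hE : MeasurableSet[m] E) {X : S → ℝ} (hX : Measurable[m] X) {δ : ℝ} {κ : ℝ≥0∞}
    (hκ : ∀ x, (μ.map G) (Set.Icc x (x + δ)) ≤ κ) :
    μ (E ∩ {ω | |X ω + 2 * G ω| ≤ δ}) ≤ κ * μ E := by
  let Z : S → ℝ × ℝ := fun ω => (E.indicator 1 ω, X ω)
  have hZm : Measurable[m] Z :=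
    (Measurable.indicator measurable_const hE : Measurable[m] (E.indicator (1 : S → ℝ))).prodMk hX
  have hZ : Measurable Z := hZm.mono hm le_rfl
  have hZG : IndepFun Z G μ := by
    rw [IndepFun_iff_Indep]
    exact indep_of_indep_of_le_left hind hZm.comap_le
  have hprod := hZG.map_prod_eq_prod_map_map hZ.aemeasurable hG.aemeasurable
  have : IsProbabilityMeasure (μ.map G) := Measure.isProbabilityMeasure_map hG.aemeasurable
  let A : Set ((ℝ × ℝ) × ℝ) := {q | q.1.1 = 1 ∧ |q.1.2 + 2 * q.2| ≤ δ}
  have hA : MeasurableSet A := by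
    apply MeasurableSet.inter
    · exact measurableSet_eq_fun (measurable_fst.comp measurable_fst) measurable_const
    · exact measurableSet_le (((measurable_snd.comp measurable_fst).add
        (measurable_snd.const_mul 2)).abs) measurable_const
  have hset : E ∩ {ω | |X ω + 2 * G ω| ≤ δ} = (fun ω => (Z ω, G ω)) ⁻¹' A := by
    ext ω
    by_cases hω : ω ∈ E <;> simp [A, Z, hω]
  rw [hset, ← Measure.map_apply (hZ.prodMk hG) hA, hprod, Measure.prod_apply hA]
  calc ∫⁻ z, (μ.map G) (Prod.mk z ⁻¹' A) ∂(μ.map Z)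
      ≤ ∫⁻ z, ({z : ℝ × ℝ | z.1 = 1}).indicator (fun _ => κ) z ∂(μ.map Z) := by
        apply lintegral_mono
        intro z
        dsimp only
        by_cases hz : z.1 = 1
        · rw [Set.indicator_of_mem (by exact hz)]
          refine le_trans (measure_mono ?_) (hκ ((-δ - z.2) / 2))
          intro y hy
          have h2 := abs_le.1 hy.2
          dsimp only at h2
          constructor <;> linarith [h2.1, h2.2]
        · rw [Set.indicator_of_notMem (by exact hz)]
          have : Prod.mk z ⁻¹' A = ∅ := by
            ext y; simp [A, hz]
          simp [this]
    _ = κ * μ E := by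
        have hM : MeasurableSet {z : ℝ × ℝ | z.1 = 1} :=
          measurableSet_eq_fun measurable_fst measurable_const
        rw [lintegral_indicator_const hM, Measure.map_apply hZ hM]
        congr 2
        ext ω
        by_cases hω : ω ∈ E <;> simp [Z, hω]

/-- One block of independent exponential durations, disjoint from the indices `J` that the other
data depend on, contributes a factor `δ / √|I|`. -/
lemma IsExpSequence.measure_inter_abs_le [IsProbabilityMeasure μ] (h : IsExpSequence μ η)
    {I J : Finset ℕ} (hIJ : Disjoint J I) (hI : 0 < I.card) {E : Set S}
    (hE : MeasurableSet[sigmaOf η J] E) {X : S → ℝ} (hX : Measurable[sigmaOf η J] X) (δ : ℝ) :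
    μ (E ∩ {ω | |X ω + 2 * blockSum η I ω| ≤ δ}) ≤ ENNReal.ofReal (δ / √I.card) * μ E :=
  WindTree.measure_inter_abs_le (h.sigmaOf_le J) (measurable_blockSum h I)
    (indep_of_indep_of_le_right (h.indep_sigmaOf hIJ)
      (measurable_blockSum_sigmaOf subset_rfl).comap_le) hE hX
    (fun x => measure_blockSum_Icc_le h hI x δ)

lemma IsExpSequence.measure_le [IsProbabilityMeasure μ] (h : IsExpSequence μ η) (i : ℕ) {x : ℝ}
    (hx : 0 ≤ x) : μ {ω | x ≤ η i ω} = ENNReal.ofReal (Real.exp (-x)) := by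
  have h1 : μ {ω | x ≤ η i ω} = expMeasure 1 (Set.Ici x) := by
    rw [← h.law i, Measure.map_apply (h.measurable i) measurableSet_Ici]; rfl
  rw [h1, expMeasure_one_eq, withDensity_apply _ measurableSet_Ici,
    ← restrict_Ioi_eq_restrict_Ici]
  have : ∀ y ∈ Set.Ioi x, erlangPDF 0 y = ENNReal.ofReal (Real.exp (-y)) := by
    intro y hy
    have : 0 ≤ y := hx.trans (le_of_lt hy)
    simp [erlangPDF, this]
  rw [setLIntegral_congr_fun measurableSet_Ioi this, ← ofReal_integral_eq_lintegral_ofReal,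
    integral_exp_neg_Ioi]
  · exact integrableOn_exp_neg_Ioi x
  · exact Eventually.of_forall fun y => (Real.exp_pos _).le

lemma IsExpSequence.tsum_measure_le [IsProbabilityMeasure μ] (h : IsExpSequence μ η) (i : ℕ)
    {ρ : ℝ} (hρ : 0 < ρ) :
    ∑' l : ℕ, μ {ω | l * ρ ≤ η i ω} ≤ ENNReal.ofReal ((1 + ρ) / ρ) := by
  have h1 : ∀ l : ℕ, μ {ω | l * ρ ≤ η i ω} = ENNReal.ofReal (Real.exp (-ρ)) ^ l := by
    intro l
    rw [h.measure_le i (by positivity), ← ENNReal.ofReal_pow (Real.exp_pos _).le,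
      ← Real.exp_nat_mul]
    congr 2; ring
  simp_rw [h1]
  rw [ENNReal.tsum_geometric, ← ENNReal.ofReal_one, ← ENNReal.ofReal_sub _ (Real.exp_pos _).le,
    ← ENNReal.ofReal_inv_of_pos]
  · apply ENNReal.ofReal_le_ofReal
    have h2 : Real.exp (-ρ) ≤ 1 / (1 + ρ) := by
      rw [Real.exp_neg, ← one_div]
      exact one_div_le_one_div_of_le (by positivity) (by linarith [Real.add_one_le_exp ρ])
    have h3 : ρ / (1 + ρ) ≤ 1 - Real.exp (-ρ) := by
      have : ρ / (1 + ρ) = 1 - 1 / (1 + ρ) := by field_simp; ring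
      linarith
    calc (1 - Real.exp (-ρ))⁻¹ ≤ (ρ / (1 + ρ))⁻¹ := inv_anti₀ (by positivity) h3
      _ = _ := by rw [inv_div]
  · have : Real.exp (-ρ) < 1 := by rw [Real.exp_lt_one_iff]; linarith
    linarith

/-- Many exponential durations are unlikely to fit in `[0, T]`: the density of the sum of `n + 1` of
them is at most `4 ^ (-n) * e ^ (3 x)`. -/
lemma IsExpSequence.measure_blockSum_le_le [IsProbabilityMeasure μ] (h : IsExpSequence μ η)
    {I : Finset ℕ} {n : ℕ} (hI : I.card = n + 1) (T : ℝ) :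
    μ {ω | blockSum η I ω ≤ T} ≤ ENNReal.ofReal ((1 / 4) ^ n * Real.exp (4 * T)) := by
  have h1 : μ {ω | blockSum η I ω ≤ T} = (μ.map (blockSum η I)) (Set.Iic T) := by
    rw [Measure.map_apply (measurable_blockSum h I) measurableSet_Iic]; rfl
  rw [h1, map_blockSum h I n hI, withDensity_apply _ measurableSet_Iic]
  have h2 : ∫⁻ x in Set.Iic T, erlangPDF n x = ∫⁻ x in Set.Icc 0 T, erlangPDF n x := by
    rw [← lintegral_indicator measurableSet_Iic, ← lintegral_indicator measurableSet_Icc]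
    congr 1
    ext x
    by_cases hx : 0 ≤ x
    · by_cases hxT : x ≤ T
      · rw [Set.indicator_of_mem (by exact hxT), Set.indicator_of_mem (by exact ⟨hx, hxT⟩)]
      · rw [Set.indicator_of_notMem (by exact hxT),
          Set.indicator_of_notMem (by exact fun q => hxT q.2)]
    · rw [Set.indicator_of_notMem (s := Set.Icc 0 T) (by exact fun q => hx q.1)]
      by_cases hxT : x ≤ T
      · rw [Set.indicator_of_mem (by exact hxT)]; simp [erlangPDF, hx]
      · rw [Set.indicator_of_notMem (by exact hxT)]
  rw [h2]
  calc ∫⁻ x in Set.Icc 0 T, erlangPDF n x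
      ≤ ∫⁻ _ in Set.Icc 0 T, ENNReal.ofReal ((1 / 4) ^ n * Real.exp (3 * T)) := by
        apply setLIntegral_mono measurable_const
        intro x hx
        refine (erlangPDF_le_exp n x).trans (ENNReal.ofReal_le_ofReal ?_)
        gcongr
        exact hx.2
    _ = ENNReal.ofReal ((1 / 4) ^ n * Real.exp (3 * T)) * ENNReal.ofReal T := by
        rw [setLIntegral_const, Real.volume_Icc]; simp
    _ ≤ _ := by
        rw [← ENNReal.ofReal_mul (by positivity)]
        apply ENNReal.ofReal_le_ofReal
        have : T ≤ Real.exp T := by linarith [Real.add_one_le_exp T]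
        calc (1 / 4) ^ n * Real.exp (3 * T) * T
            ≤ (1 / 4) ^ n * Real.exp (3 * T) * Real.exp T := by gcongr
          _ = _ := by rw [mul_assoc, ← Real.exp_add]; congr 2; ring

end ExpSequence

/-! ### The probability of a hit along a given path of directions -/

/-- The set of flipped coordinates of a velocity relative to `v₀`, as an element of `(ℤ/2)³`. -/
abbrev Flips : Type := Fin 3 → ZMod 2

/-- The flip of the single coordinate `i`. -/
def single (i : Fin 3) : Flips := Pi.single i 1

lemma single_injective : Function.Injective single := by
  intro k k' hkk
  by_contra hne
  have := congrFun hkk k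
  simp [single, Pi.single_eq_of_ne hne] at this

/-- The sign of coordinate `j` relative to `v₀`. -/
def sgn (x : Flips) (j : Fin 3) : ℝ := if x j = 0 then 1 else -1

lemma sgn_mul_self (x : Flips) (j : Fin 3) : sgn x j * sgn x j = 1 := by
  unfold sgn; split_ifs <;> norm_num

lemma abs_sgn (x : Flips) (j : Fin 3) : |sgn x j| = 1 := by
  unfold sgn; split_ifs <;> norm_num

lemma sgn_add_single (x : Flips) (i j : Fin 3) :
    sgn (x + single i) j = if j = i then -sgn x j else sgn x j := by
  have key : ∀ a : ZMod 2, (a + 1 = 0) ↔ ¬ a = 0 := by decide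
  unfold sgn single
  by_cases h : j = i
  · subst h
    simp only [Pi.add_apply, Pi.single_eq_same, key, if_true]
    by_cases h2 : x j = 0 <;> simp [h2]
  · simp [h]

/-- The sum of the signs of the two coordinates other than `k`. -/
def pairSgn (k : Fin 3) (x : Flips) : ℝ := sgn x (k + 1) + sgn x (k + 2)

/-- The three velocities `ϑ_i v₀` separate: the pairs of coordinates see them one at a time. -/
lemma pairSgn_single (k i : Fin 3) : pairSgn k (single i) = if i = k then 2 else 0 := by
  unfold pairSgn sgn single
  fin_cases k <;> fin_cases i <;> simp <;> norm_num

/-- In normalised coordinates (divided by those of `v₀`): the displacement over the flights in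
`Ico a b`, prolonged by a part of flight `c`, lies in the cube of side `2 ρ`. Flight `i` has
direction `x i` and duration `η i`. -/
def SignHit (x : ℕ → Flips) (a b c : ℕ) (ρ : ℝ) (η : ℕ → ℝ) : Prop :=
  ∃ s, 0 ≤ s ∧ s ≤ η c ∧
    ∀ j, |∑ i ∈ Finset.Ico a b, η i * sgn (x i) j + s * sgn (x c) j| ≤ ρ

/-- The number of flights in `Ico a b` with direction `y`. -/
def occupation (x : ℕ → Flips) (y : Flips) (a b : ℕ) : ℕ :=
  ((Finset.Ico a b).filter (fun i => x i = y)).card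

section Hit
variable {S : Type*} [MeasurableSpace S] {μ : Measure S} {η : ℕ → S → ℝ}

/-- Two successive flights are not parallel, so the duration of one of them must fall in an
interval of length of order `ρ`. -/
lemma measure_signHit_le_linear [IsProbabilityMeasure μ] (h : IsExpSequence μ η) {x : ℕ → Flips}
    {a b c d : ℕ} (hd : d ∈ Finset.Ico a b) (k : Fin 3) (hx : x d = x c + single k) {ρ : ℝ} :
    μ {ω | SignHit x a b c ρ (fun i => η i ω)} ≤ ENNReal.ofReal (2 * ρ) := by
  set J := (Finset.Ico a b).erase d with hJ
  have hne : k + 1 ≠ k := by fin_cases k <;> decide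
  -- Subtracting the conditions in coordinates `k + 1` and `k`, normalised by the signs of flight
  -- `c`, eliminates the time spent on flight `c` and leaves twice the duration of flight `d`.
  let w : ℕ → ℝ := fun i =>
    sgn (x i) (k + 1) * sgn (x c) (k + 1) - sgn (x i) k * sgn (x c) k
  have hsub : {ω | SignHit x a b c ρ (fun i => η i ω)} ⊆
      Set.univ ∩ {ω | |∑ i ∈ J, η i ω * w i + 2 * blockSum η {d} ω| ≤ 2 * ρ} := by
    rintro ω ⟨s, -, -, hs⟩
    refine ⟨trivial, ?_⟩
    have h1 := hs (k + 1)
    have h2 := hs k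
    have e : ∑ i ∈ J, η i ω * w i + 2 * blockSum η {d} ω =
        (∑ i ∈ Finset.Ico a b, η i ω * sgn (x i) (k + 1) + s * sgn (x c) (k + 1)) *
            sgn (x c) (k + 1) -
          (∑ i ∈ Finset.Ico a b, η i ω * sgn (x i) k + s * sgn (x c) k) * sgn (x c) k := by
      have e1 : ∑ i ∈ Finset.Ico a b, η i ω * w i =
          (∑ i ∈ Finset.Ico a b, η i ω * sgn (x i) (k + 1)) * sgn (x c) (k + 1) -
            (∑ i ∈ Finset.Ico a b, η i ω * sgn (x i) k) * sgn (x c) k := by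
        rw [Finset.sum_mul, Finset.sum_mul, ← Finset.sum_sub_distrib]
        exact Finset.sum_congr rfl fun i _ => by simp only [w]; ring
      have e2 : w d = 2 := by
        simp only [w, hx, sgn_add_single, hne, if_true, if_false]
        linarith [sgn_mul_self (x c) k, sgn_mul_self (x c) (k + 1)]
      have e3 : ∑ i ∈ Finset.Ico a b, η i ω * w i =
          ∑ i ∈ J, η i ω * w i + 2 * blockSum η {d} ω := by
        rw [← Finset.sum_erase_add _ _ hd, e2]
        simp [hJ, blockSum]
        ring
      rw [← e3, e1]
      linear_combination (-s) * sgn_mul_self (x c) (k + 1) + s * sgn_mul_self (x c) k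
    rw [Set.mem_ofPred_eq, e]
    refine (abs_sub _ _).trans ?_
    rw [abs_mul, abs_mul, abs_sgn, abs_sgn]
    linarith
  refine (measure_mono hsub).trans ((h.measure_inter_abs_le (J := J) (I := {d})
    (by simp [hJ]) (by simp) MeasurableSet.univ (measurable_sum_sigmaOf subset_rfl w) _).trans ?_)
  simp

/-- If the path visits each direction `ϑ_i v₀`, the three total durations in these directions are
independent of the rest and each has to fall in an interval of length of order `ρ`, once the
position on flight `c` is discretised on the scale `ρ`. -/
lemma measure_signHit_le_cubic [IsProbabilityMeasure μ] (h : IsExpSequence μ η) {x : ℕ → Flips}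
    {a b c : ℕ} (hc : c ∉ Finset.Ico a b) {ρ : ℝ} (hρ : 0 < ρ)
    (hN : ∀ k, 0 < occupation x (single k) a b) :
    μ {ω | SignHit x a b c ρ (fun i => η i ω)} ≤
      (∏ k, ENNReal.ofReal (4 * ρ / √(occupation x (single k) a b))) *
        ENNReal.ofReal ((1 + ρ) / ρ) := by
  let I : Fin 3 → Finset ℕ := fun k => (Finset.Ico a b).filter (fun i => x i = single k)
  let R : Finset ℕ := (Finset.Ico a b).filter (fun i => ∀ k, x i ≠ single k)
  have hII : ∀ {k k'}, k ≠ k' → Disjoint (I k) (I k') := by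
    intro k k' hkk
    rw [Finset.disjoint_left]
    intro i hi hi'
    simp only [I, Finset.mem_filter] at hi hi'
    exact hkk (single_injective (hi.2.symm.trans hi'.2))
  have hRI : ∀ k, Disjoint R (I k) := by
    intro k
    rw [Finset.disjoint_left]
    intro i hi hi'
    simp only [I, R, Finset.mem_filter] at hi hi'
    exact hi.2 k hi'.2
  have hcI : ∀ k, Disjoint {c} (I k) := by
    intro k
    rw [Finset.disjoint_singleton_left]
    exact fun hcc => hc (Finset.mem_filter.1 hcc).1
  -- The sum of the coordinates other than `k` is `Z l k` plus twice the time in direction `ϑ_k v₀`,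
  -- when the time spent on flight `c` is rounded down to `l * ρ`.
  let Z : ℕ → Fin 3 → S → ℝ := fun l k ω =>
    ∑ i ∈ R, η i ω * pairSgn k (x i) + l * ρ * pairSgn k (x c)
  let B : ℕ → Fin 3 → Set S := fun l k => {ω | |Z l k ω + 2 * blockSum η (I k) ω| ≤ 4 * ρ}
  let E : ℕ → Set S := fun l => {ω | l * ρ ≤ η c ω}
  have hsub : {ω | SignHit x a b c ρ (fun i => η i ω)} ⊆
      ⋃ l : ℕ, ((E l ∩ B l 0) ∩ B l 1) ∩ B l 2 := by
    rintro ω ⟨s, hs0, hsc, hs⟩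
    have hfl := Nat.floor_le (div_nonneg hs0 hρ.le)
    have hfl2 := Nat.lt_floor_add_one (s / ρ)
    set l := ⌊s / ρ⌋₊ with hl
    rw [le_div_iff₀ hρ] at hfl
    rw [div_lt_iff₀ hρ] at hfl2
    have hB : ∀ k, ω ∈ B l k := by
      intro k
      have e : Z l k ω + 2 * blockSum η (I k) ω =
          (∑ i ∈ Finset.Ico a b, η i ω * sgn (x i) (k + 1) + s * sgn (x c) (k + 1)) +
            (∑ i ∈ Finset.Ico a b, η i ω * sgn (x i) (k + 2) + s * sgn (x c) (k + 2)) -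
            (s - l * ρ) * (sgn (x c) (k + 1) + sgn (x c) (k + 2)) := by
        have e1 : ∑ i ∈ Finset.Ico a b, η i ω * pairSgn k (x i) =
            ∑ i ∈ R, η i ω * pairSgn k (x i) + 2 * blockSum η (I k) ω := by
          have e2 : ∑ i ∈ R ∪ I k, η i ω * pairSgn k (x i) =
              ∑ i ∈ Finset.Ico a b, η i ω * pairSgn k (x i) := by
            apply Finset.sum_subset
            · exact Finset.union_subset (Finset.filter_subset _ _) (Finset.filter_subset _ _)
            · intro i hi hi'
              have h1 : ∃ k', x i = single k' := by
                by_contra hcon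
                push Not at hcon
                exact hi' (Finset.mem_union_left _ (Finset.mem_filter.2 ⟨hi, hcon⟩))
              obtain ⟨k', hk'⟩ := h1
              have h2 : k' ≠ k := by
                rintro rfl
                exact hi' (Finset.mem_union_right _ (Finset.mem_filter.2 ⟨hi, hk'⟩))
              rw [hk', pairSgn_single, if_neg h2, mul_zero]
          rw [← e2, Finset.sum_union (hRI k), blockSum, Finset.mul_sum]
          congr 1
          refine Finset.sum_congr rfl fun i hi => ?_
          rw [(Finset.mem_filter.1 hi).2, pairSgn_single, if_pos rfl, mul_comm]
        have e3 : ∑ i ∈ Finset.Ico a b, η i ω * pairSgn k (x i) =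
            ∑ i ∈ Finset.Ico a b, η i ω * sgn (x i) (k + 1) +
              ∑ i ∈ Finset.Ico a b, η i ω * sgn (x i) (k + 2) := by
          rw [← Finset.sum_add_distrib]
          exact Finset.sum_congr rfl fun i _ => by unfold pairSgn; ring
        simp only [Z]
        rw [e3] at e1
        unfold pairSgn at e1 ⊢
        linarith
      simp only [B, Set.mem_ofPred_eq]
      rw [e]
      have h1 := abs_le.1 (hs (k + 1))
      have h2 := abs_le.1 (hs (k + 2))
      have h3 := abs_le.1 (abs_sgn (x c) (k + 1)).le
      have h4 := abs_le.1 (abs_sgn (x c) (k + 2)).le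
      have h5 : 0 ≤ s - l * ρ := by linarith
      have h6 : s - l * ρ ≤ ρ := by linarith
      have h7 : |(s - l * ρ) * (sgn (x c) (k + 1) + sgn (x c) (k + 2))| ≤ ρ * 2 := by
        rw [abs_mul, abs_of_nonneg h5]
        exact mul_le_mul h6 (abs_le.2 ⟨by linarith, by linarith⟩) (abs_nonneg _) hρ.le
      have h8 := abs_le.1 h7
      exact abs_le.2 ⟨by linarith, by linarith⟩
    exact Set.mem_iUnion.2 ⟨l, ⟨⟨hfl.trans hsc, hB 0⟩, hB 1⟩, hB 2⟩
  have hZ : ∀ (l : ℕ) (k : Fin 3) {J : Finset ℕ}, R ⊆ J → Measurable[sigmaOf η J] (Z l k) :=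
    fun l k J hJ => (measurable_sum_sigmaOf hJ _).add_const _
  have hBm : ∀ (l : ℕ) (k : Fin 3) {J : Finset ℕ}, R ⊆ J → I k ⊆ J →
      MeasurableSet[sigmaOf η J] (B l k) := by
    intro l k J hR hI
    have hm : Measurable[sigmaOf η J] (fun ω => Z l k ω + 2 * blockSum η (I k) ω) :=
      (hZ l k hR).add ((measurable_blockSum_sigmaOf hI).const_mul 2)
    exact hm (measurableSet_le measurable_id.abs measurable_const :
      MeasurableSet {y : ℝ | |y| ≤ 4 * ρ})
  have hEm : ∀ (l : ℕ) {J : Finset ℕ}, c ∈ J → MeasurableSet[sigmaOf η J] (E l) :=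
    fun l J hJ => (measurable_sigmaOf hJ) (measurableSet_Ici (a := l * ρ))
  have hl : ∀ l, μ (((E l ∩ B l 0) ∩ B l 1) ∩ B l 2) ≤
      (∏ k, ENNReal.ofReal (4 * ρ / √(occupation x (single k) a b))) * μ (E l) := by
    intro l
    -- The three blocks are released one after the other; the earlier ones count as frozen data.
    let J0 : Finset ℕ := {c} ∪ R
    let J1 : Finset ℕ := J0 ∪ I 0
    let J2 : Finset ℕ := J1 ∪ I 1
    have hc0 : c ∈ J0 := by simp [J0]
    have hR0 : R ⊆ J0 := Finset.subset_union_right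
    have h01 : J0 ⊆ J1 := Finset.subset_union_left
    have h12 : J1 ⊆ J2 := Finset.subset_union_left
    have d0 : ∀ k, Disjoint J0 (I k) := fun k => Finset.disjoint_union_left.2 ⟨hcI k, hRI k⟩
    have d1 : ∀ k, k ≠ 0 → Disjoint J1 (I k) :=
      fun k hk => Finset.disjoint_union_left.2 ⟨d0 k, hII hk.symm⟩
    have d2 : Disjoint J2 (I 2) :=
      Finset.disjoint_union_left.2 ⟨d1 2 (by decide), hII (by decide)⟩
    have s0 := h.measure_inter_abs_le (d0 0) (hN 0) (hEm l hc0) (hZ l 0 hR0) (4 * ρ)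
    have s1 := h.measure_inter_abs_le (d1 1 (by decide)) (hN 1)
      ((hEm l (h01 hc0)).inter (hBm l 0 (hR0.trans h01) Finset.subset_union_right))
      (hZ l 1 (hR0.trans h01)) (4 * ρ)
    have s2 := h.measure_inter_abs_le d2 (hN 2)
      (((hEm l (h12 (h01 hc0))).inter
        (hBm l 0 ((hR0.trans h01).trans h12) (Finset.subset_union_right.trans h12))).inter
        (hBm l 1 ((hR0.trans h01).trans h12) Finset.subset_union_right))
      (hZ l 2 ((hR0.trans h01).trans h12)) (4 * ρ)
    calc μ (((E l ∩ B l 0) ∩ B l 1) ∩ B l 2)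
        ≤ ENNReal.ofReal (4 * ρ / √(I 2).card) * (ENNReal.ofReal (4 * ρ / √(I 1).card) *
            (ENNReal.ofReal (4 * ρ / √(I 0).card) * μ (E l))) := by
          refine s2.trans ?_
          gcongr
          refine s1.trans ?_
          gcongr
      _ = _ := by
          rw [Fin.prod_univ_three]
          change _ = ENNReal.ofReal (4 * ρ / √(I 0).card) * ENNReal.ofReal (4 * ρ / √(I 1).card) *
            ENNReal.ofReal (4 * ρ / √(I 2).card) * _
          ring
  calc μ {ω | SignHit x a b c ρ (fun i => η i ω)}
      ≤ ∑' l, μ (((E l ∩ B l 0) ∩ B l 1) ∩ B l 2) :=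
        (measure_mono hsub).trans (measure_iUnion_le _)
    _ ≤ ∑' l, (∏ k, ENNReal.ofReal (4 * ρ / √(occupation x (single k) a b))) * μ (E l) :=
        ENNReal.tsum_le_tsum hl
    _ ≤ _ := by
        rw [ENNReal.tsum_mul_left]
        gcongr
        exact h.tsum_measure_le c hρ

/-- The decay rate `(q + 1) ^ (-3/2)` of the probability that a three-dimensional walk returns to
a fixed bounded region. -/
def decay (q : ℕ) : ℝ≥0∞ := ENNReal.ofReal (1 / ((q + 1) * √(q + 1)))

lemma decay_antitone : Antitone decay := by
  intro q q' hq
  apply ENNReal.ofReal_le_ofReal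
  have : (q : ℝ) ≤ q' := by exact_mod_cast hq
  gcongr

lemma tsum_decay_ne_top : ∑' q, decay q ≠ ∞ := by
  have h : Summable (fun q : ℕ => 1 / (((q : ℝ) + 1) * √(q + 1))) := by
    have h1 := (summable_nat_add_iff 1).2
      (Real.summable_one_div_nat_rpow.2 (by norm_num : (1 : ℝ) < 3 / 2))
    refine h1.congr fun q => ?_
    have : (0 : ℝ) < q + 1 := by positivity
    push_cast
    rw [Real.sqrt_eq_rpow, show (3 : ℝ) / 2 = 1 + 1 / 2 by norm_num, Real.rpow_add this,
      Real.rpow_one]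
  exact h.tsum_ofReal_ne_top

/-- Both bounds together: a hit has probability `O(ρ)`, with a summable decay in the numbers of
visits to the three directions `ϑ_i v₀`. -/
lemma measure_signHit_le [IsProbabilityMeasure μ] (h : IsExpSequence μ η) {x : ℕ → Flips}
    {a b c d : ℕ} (hc : c ∉ Finset.Ico a b) (hd : d ∈ Finset.Ico a b) (k : Fin 3)
    (hx : x d = x c + single k) {ρ : ℝ} (hρ : 0 < ρ) :
    μ {ω | SignHit x a b c ρ (fun i => η i ω)} ≤
      ENNReal.ofReal (256 * ρ * (1 + ρ) ^ 2) * ∑ k, decay (occupation x (single k) a b) := by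
  -- The direction visited least often decides which of the two bounds is used.
  obtain ⟨k₀, -, hk₀⟩ := Finset.exists_min_image Finset.univ
    (fun k => occupation x (single k) a b) ⟨0, Finset.mem_univ 0⟩
  set N := occupation x (single k₀) a b with hN
  suffices hs : μ {ω | SignHit x a b c ρ (fun i => η i ω)} ≤
      ENNReal.ofReal (256 * ρ * (1 + ρ) ^ 2) * decay N by
    refine hs.trans ?_
    gcongr
    exact Finset.single_le_sum (f := fun k => decay (occupation x (single k) a b))
      (fun _ _ => zero_le) (Finset.mem_univ k₀)
  unfold decay
  rw [← ENNReal.ofReal_mul (by positivity)]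
  rcases Nat.eq_zero_or_pos N with h0 | hpos
  · refine (measure_signHit_le_linear h hd k hx).trans (ENNReal.ofReal_le_ofReal ?_)
    rw [h0]
    simp
    nlinarith [mul_pos hρ hρ, mul_pos hρ (mul_pos hρ hρ)]
  · have hall : ∀ k, N ≤ occupation x (single k) a b := fun k => hk₀ k (Finset.mem_univ k)
    have hN1 : (1 : ℝ) ≤ N := by exact_mod_cast hpos
    have hN0 : (0 : ℝ) < N := by linarith
    refine (measure_signHit_le_cubic h hc hρ (fun k => hpos.trans_le (hall k))).trans ?_
    calc (∏ k, ENNReal.ofReal (4 * ρ / √(occupation x (single k) a b))) *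
          ENNReal.ofReal ((1 + ρ) / ρ)
        ≤ (∏ _k : Fin 3, ENNReal.ofReal (4 * ρ / √N)) * ENNReal.ofReal ((1 + ρ) / ρ) := by
          gcongr with k
          exact hall k
      _ = ENNReal.ofReal ((4 * ρ / √N) ^ 3 * ((1 + ρ) / ρ)) := by
          rw [Finset.prod_const, Finset.card_univ, Fintype.card_fin,
            ← ENNReal.ofReal_pow (by positivity), ← ENNReal.ofReal_mul (by positivity)]
      _ ≤ _ := by
          apply ENNReal.ofReal_le_ofReal
          have hs : √((N : ℝ) + 1) ≤ 2 * √N := by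
            rw [show (2 : ℝ) * √N = √(4 * N) by
              rw [Real.sqrt_mul (by norm_num), show (4 : ℝ) = 2 ^ 2 by norm_num,
                Real.sqrt_sq (by norm_num)]]
            exact Real.sqrt_le_sqrt (by linarith)
          have hsq : √(N : ℝ) ^ 2 = N := Real.sq_sqrt hN0.le
          have e1 : (4 * ρ / √(N : ℝ)) ^ 3 * ((1 + ρ) / ρ) =
              64 * ρ * (1 + ρ) * ρ * (1 / (N * √N)) := by
            rw [div_pow, show √(N : ℝ) ^ 3 = √(N : ℝ) ^ 2 * √N by ring, hsq]
            field_simp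
            ring
          have e2 : 1 / ((N : ℝ) * √N) ≤ 4 * (1 / ((N + 1) * √(N + 1))) := by
            rw [mul_one_div, div_le_div_iff₀ (by positivity) (by positivity)]
            have : ((N : ℝ) + 1) * √(N + 1) ≤ (2 * N) * (2 * √N) :=
              mul_le_mul (by linarith) hs (by positivity) (by positivity)
            linarith
          rw [e1]
          calc 64 * ρ * (1 + ρ) * ρ * (1 / ((N : ℝ) * √N))
              ≤ 64 * ρ * (1 + ρ) * (1 + ρ) * (4 * (1 / ((N + 1) * √(N + 1)))) := by
                gcongr
                linarith
            _ = _ := by ring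

end Hit

/-! ### Words of flips and the walk on `(ℤ/2)³` -/

lemma flips_add_self (x : Flips) : x + x = 0 := CharTwo.add_self_eq_zero x

lemma flips_add_eq_zero {x y : Flips} : x + y = 0 ↔ y = x := by
  constructor
  · intro h
    have := flips_add_self x
    exact add_left_cancel (h.trans this.symm)
  · rintro rfl; exact flips_add_self _

/-- The composition of the flips listed in a word. -/
def pos (w : List (Fin 3)) : Flips := (w.map single).sum

@[simp] lemma pos_nil : pos [] = 0 := rfl

@[simp] lemma pos_cons (i : Fin 3) (w : List (Fin 3)) : pos (i :: w) = single i + pos w := by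
  simp [pos]

@[simp] lemma pos_append (a b : List (Fin 3)) : pos (a ++ b) = pos a + pos b := by
  simp [pos]

@[simp] lemma pos_reverse (a : List (Fin 3)) : pos a.reverse = pos a := by
  induction a with
  | nil => rfl
  | cons i a ih => simp [ih, add_comm]

lemma pos_take_add_pos_drop (a : List (Fin 3)) (n : ℕ) :
    pos (a.take n) + pos (a.drop n) = pos a := by
  rw [← pos_append, List.take_append_drop]

/-- The number of times `1 ≤ l ≤ |w|` at which the walk started from `y` and driven by the word
`w` is at `0`. -/
def visits : Flips → List (Fin 3) → ℕ
  | _, [] => 0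
  | y, i :: w => (if y + single i = 0 then 1 else 0) + visits (y + single i) w

lemma visits_append (y : Flips) (a b : List (Fin 3)) :
    visits y (a ++ b) = visits y a + visits (y + pos a) b := by
  induction a generalizing y with
  | nil => simp [visits]
  | cons i a ih => simp [visits, ih, add_assoc]

lemma visits_eq_sum (y : Flips) (w : List (Fin 3)) :
    visits y w = ∑ l ∈ Finset.range w.length, if y + pos (w.take (l + 1)) = 0 then 1 else 0 := by
  induction w generalizing y with
  | nil => simp [visits]
  | cons i w ih =>
    rw [List.length_cons, Finset.sum_range_succ', visits, ih, add_comm]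
    simp [add_assoc]

lemma visits_pos {y : Flips} {w : List (Fin 3)} (hw : w ≠ []) (h : y + pos w = 0) :
    0 < visits y w := by
  have hl : 0 < w.length := List.length_pos_iff.2 hw
  rw [visits_eq_sum]
  refine lt_of_lt_of_le zero_lt_one ?_
  refine le_trans (le_of_eq ?_) (Finset.single_le_sum
    (f := fun l => if y + pos (w.take (l + 1)) = 0 then 1 else 0) (fun _ _ => Nat.zero_le _)
    (Finset.mem_range.2 (Nat.sub_lt hl zero_lt_one)))
  have : w.length - 1 + 1 = w.length := by omega
  simp [this, h]

/-- The path of directions driven by a word, started from `0`; it is constant after the end of the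
word. -/
def path (w : List (Fin 3)) (l : ℕ) : Flips := pos (w.take l)

lemma path_append {a b : List (Fin 3)} {l : ℕ} (hl : l ≤ a.length) :
    path (a ++ b) l = path a l := by
  rw [path, path, List.take_append_of_le_length hl]

lemma path_succ {w : List (Fin 3)} {l : ℕ} (hl : l < w.length) :
    path w (l + 1) = path w l + single w[l] := by
  rw [path, path, List.take_succ_eq_append_getElem hl, pos_append]
  simp

lemma occupation_eq_sum (x : ℕ → Flips) (y : Flips) (a b : ℕ) :
    occupation x y a b = ∑ i ∈ Finset.Ico a b, if x i = y then 1 else 0 := by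
  rw [occupation, Finset.card_filter]

lemma occupation_congr {x x' : ℕ → Flips} (y : Flips) {a b : ℕ}
    (h : ∀ i ∈ Finset.Ico a b, x i = x' i) : occupation x y a b = occupation x' y a b := by
  rw [occupation_eq_sum, occupation_eq_sum]
  exact Finset.sum_congr rfl fun i hi => by rw [h i hi]

lemma occupation_mono (x : ℕ → Flips) (y : Flips) {a b a' b' : ℕ} (ha : a' ≤ a) (hb : b ≤ b') :
    occupation x y a b ≤ occupation x y a' b' :=
  Finset.card_le_card (Finset.filter_subset_filter _ (Finset.Ico_subset_Ico ha hb))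

/-- Reading a closed loop backwards, the last `n` directions become the first `n` ones. -/
lemma occupation_path_eq_visits {a : List (Fin 3)} {n d : ℕ} (ha : a.length = n + d)
    (h0 : pos a = 0) (y : Flips) :
    occupation (path a) y d (n + d) = visits y (a.reverse.take n) := by
  have hlen : (a.reverse.take n).length = n := by simp [ha]
  rw [occupation_eq_sum, Finset.sum_Ico_eq_sum_range, visits_eq_sum, hlen, Nat.add_sub_cancel,
    ← Finset.sum_range_reflect]
  refine Finset.sum_congr rfl fun l hl => ?_
  rw [Finset.mem_range] at hl
  have e : pos ((a.reverse.take n).take (l + 1)) = path a (d + (n - 1 - l)) := by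
    rw [List.take_take, min_eq_left (by omega), List.take_reverse, pos_reverse, ha,
      show n + d - (l + 1) = d + (n - 1 - l) by omega, path]
    have := pos_take_add_pos_drop a (d + (n - 1 - l))
    rw [h0, flips_add_eq_zero] at this
    exact this
  simp only [e, flips_add_eq_zero]

section WordSum
variable {q : Fin 3 → ℝ≥0∞}

/-- The expectation of `F` over words of `n` independent letters of law `q`. -/
def wordSum (q : Fin 3 → ℝ≥0∞) : ℕ → (List (Fin 3) → ℝ≥0∞) → ℝ≥0∞
  | 0, F => F []
  | n + 1, F => ∑ i, q i * wordSum q n (fun w => F (i :: w))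

lemma wordSum_mono {n : ℕ} {F G : List (Fin 3) → ℝ≥0∞} (h : ∀ w, w.length = n → F w ≤ G w) :
    wordSum q n F ≤ wordSum q n G := by
  induction n generalizing F G with
  | zero => exact h [] rfl
  | succ n ih =>
    unfold wordSum
    gcongr with i
    exact ih fun w hw => h _ (by simp [hw])

lemma wordSum_congr {n : ℕ} {F G : List (Fin 3) → ℝ≥0∞} (h : ∀ w, w.length = n → F w = G w) :
    wordSum q n F = wordSum q n G :=
  le_antisymm (wordSum_mono fun w hw => (h w hw).le) (wordSum_mono fun w hw => (h w hw).ge)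

lemma wordSum_const_mul (n : ℕ) (c : ℝ≥0∞) (F : List (Fin 3) → ℝ≥0∞) :
    wordSum q n (fun w => c * F w) = c * wordSum q n F := by
  induction n generalizing F with
  | zero => rfl
  | succ n ih =>
    simp only [wordSum, ih, Finset.mul_sum]
    exact Finset.sum_congr rfl fun i _ => by ring

lemma wordSum_tsum {ι : Type*} (n : ℕ) (F : ι → List (Fin 3) → ℝ≥0∞) :
    wordSum q n (fun w => ∑' j, F j w) = ∑' j, wordSum q n (F j) := by
  induction n generalizing F with
  | zero => rfl
  | succ n ih =>
    simp only [wordSum, ih]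
    rw [Summable.tsum_finsetSum (fun _ _ => ENNReal.summable)]
    exact Finset.sum_congr rfl fun i _ => ENNReal.tsum_mul_left.symm

lemma wordSum_sum {ι : Type*} (s : Finset ι) (n : ℕ) (F : ι → List (Fin 3) → ℝ≥0∞) :
    wordSum q n (fun w => ∑ j ∈ s, F j w) = ∑ j ∈ s, wordSum q n (F j) := by
  induction n generalizing F with
  | zero => rfl
  | succ n ih =>
    simp only [wordSum, ih]
    rw [Finset.sum_comm]
    exact Finset.sum_congr rfl fun i _ => by rw [Finset.mul_sum]

lemma wordSum_const (hq : ∑ i, q i = 1) (n : ℕ) (c : ℝ≥0∞) : wordSum q n (fun _ => c) = c := by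
  induction n with
  | zero => rfl
  | succ n ih => simp only [wordSum, ih, ← Finset.sum_mul, hq, one_mul]

lemma wordSum_append (n m : ℕ) (F : List (Fin 3) → ℝ≥0∞) :
    wordSum q (n + m) F = wordSum q n (fun a => wordSum q m (fun b => F (a ++ b))) := by
  induction n generalizing F with
  | zero => simp [wordSum]
  | succ n ih =>
    rw [Nat.succ_add n m]
    simp only [wordSum, ih, List.cons_append]

/-- The law of a word of independent letters is invariant under reversal. -/
lemma wordSum_reverse (n : ℕ) (F : List (Fin 3) → ℝ≥0∞) :
    wordSum q n (fun w => F w.reverse) = wordSum q n F := by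
  induction n generalizing F with
  | zero => rfl
  | succ n ih =>
    rw [wordSum_append n 1]
    simp only [wordSum, List.reverse_append, List.reverse_singleton, List.singleton_append]
    rw [wordSum_sum]
    refine Finset.sum_congr rfl fun i _ => ?_
    rw [wordSum_const_mul, ih (fun w => F (i :: w))]

/-- A bound for the expected time to reach `0`: a supersolution of the hitting time equation of the
walk on `(ℤ/2)³`. -/
def IsHittingBound (q : Fin 3 → ℝ≥0∞) (φ : Flips → ℝ≥0∞) : Prop :=
  ∀ y, 1 + ∑ i, q i * (if y + single i = 0 then 0 else φ (y + single i)) ≤ φ y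

/-- The potential estimate: if a quantity decays like `g` in the number of visits to `0`, its
expected sum over time is at most the sum of `g` times the expected time between two visits. -/
lemma sum_wordSum_visits_le (hq : ∑ i, q i = 1) {φ : Flips → ℝ≥0∞} (hφ : IsHittingBound q φ)
    (g : ℕ → ℝ≥0∞) (M : ℕ) (y : Flips) (c : ℕ) :
    ∑ n ∈ Finset.range M, wordSum q n (fun w => g (c + visits y w)) ≤
      φ y * g c + φ 0 * ∑' k, g (c + 1 + k) := by
  induction M generalizing y c with
  | zero => simp
  | succ M ih =>
    rw [Finset.sum_range_succ']
    have e : ∑ n ∈ Finset.range M, wordSum q (n + 1) (fun w => g (c + visits y w)) =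
        ∑ i, q i * ∑ n ∈ Finset.range M, wordSum q n
          (fun w => g ((c + if y + single i = 0 then 1 else 0) + visits (y + single i) w)) := by
      simp only [wordSum, visits, Finset.mul_sum, ← add_assoc]
      rw [Finset.sum_comm]
    have hi : ∀ i, ∑ n ∈ Finset.range M, wordSum q n
        (fun w => g ((c + if y + single i = 0 then 1 else 0) + visits (y + single i) w)) ≤
        (if y + single i = 0 then 0 else φ (y + single i)) * g c + φ 0 * ∑' k, g (c + 1 + k) := by
      intro i
      refine (ih _ _).trans ?_
      split_ifs with h
      · rw [h, tsum_eq_zero_add' (f := fun k => g (c + 1 + k)) ENNReal.summable, mul_add, zero_mul,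
          zero_add]
        simp [add_comm, add_left_comm]
      · simp
    rw [e]
    calc ∑ i, q i * ∑ n ∈ Finset.range M, wordSum q n
          (fun w => g ((c + if y + single i = 0 then 1 else 0) + visits (y + single i) w)) +
            wordSum q 0 (fun w => g (c + visits y w))
        ≤ ∑ i, q i * ((if y + single i = 0 then 0 else φ (y + single i)) * g c +
            φ 0 * ∑' k, g (c + 1 + k)) + g c := by
          gcongr with i
          · exact hi i
          · simp [wordSum, visits]
      _ = (1 + ∑ i, q i * (if y + single i = 0 then 0 else φ (y + single i))) * g c +
            φ 0 * ∑' k, g (c + 1 + k) := by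
          simp only [mul_add, Finset.sum_add_distrib, ← Finset.sum_mul, hq, ← mul_assoc]
          ring
      _ ≤ _ := by
          gcongr
          exact hφ y

lemma tsum_wordSum_visits_le (hq : ∑ i, q i = 1) {φ : Flips → ℝ≥0∞} (hφ : IsHittingBound q φ)
    (g : ℕ → ℝ≥0∞) (y : Flips) :
    ∑' n, wordSum q n (fun w => g (visits y w)) ≤ φ y * g 0 + φ 0 * ∑' k, g (1 + k) := by
  refine ENNReal.tsum_le_of_sum_range_le fun M => ?_
  simpa using sum_wordSum_visits_le hq hφ g M y 0

/-- The expected length of an excursion is finite. -/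
lemma tsum_wordSum_visits_eq_zero_le (hq : ∑ i, q i = 1) {φ : Flips → ℝ≥0∞}
    (hφ : IsHittingBound q φ) (y : Flips) :
    ∑' n, wordSum q n (fun w => if visits y w = 0 then 1 else 0) ≤ φ y := by
  refine (tsum_wordSum_visits_le hq hφ (fun k => if k = 0 then 1 else 0) y).trans ?_
  simp

/-- The walk makes its `J`-th visit to `0` at most once. -/
lemma tsum_wordSum_return_le_one (hq : ∑ i, q i = 1) (y : Flips) (c J : ℕ) :
    ∑' d, wordSum q d (fun b => if y + pos b = 0 ∧ c + visits y b = J then 1 else 0) ≤ 1 := by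
  refine ENNReal.tsum_le_of_sum_range_le fun M => ?_
  induction M generalizing y c with
  | zero => simp
  | succ M ih =>
    rw [Finset.sum_range_succ']
    rcases lt_or_ge c J with hc | hc
    · have h0 : wordSum q 0 (fun b => if y + pos b = 0 ∧ c + visits y b = J then 1 else 0) = 0 := by
        simp [wordSum, visits, hc.ne]
      rw [h0, add_zero]
      simp only [wordSum]
      rw [Finset.sum_comm]
      simp only [← Finset.mul_sum]
      calc _ ≤ ∑ i, q i * 1 := by
            gcongr with i
            simp only [pos_cons, visits, ← add_assoc]
            exact ih (y + single i) (c + if y + single i = 0 then 1 else 0)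
        _ = 1 := by simp [hq]
    · have h0 : ∀ n, wordSum q (n + 1)
          (fun b => if y + pos b = 0 ∧ c + visits y b = J then 1 else 0) = 0 := by
        intro n
        rw [← wordSum_const hq (n + 1) 0]
        refine wordSum_congr fun w hw => ?_
        rw [wordSum_const hq]
        refine if_neg ?_
        rintro ⟨h1, h2⟩
        have := visits_pos (by rintro rfl; simp at hw) h1
        omega
      simp only [h0, Finset.sum_const_zero, zero_add]
      simp only [wordSum]
      split_ifs <;> simp

/-- Green's function bound for the past of an excursion: reading the past backwards from its last
visit to `0`, the visits to the direction `y` among the last `n` flights are those of a walk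
started afresh. -/
lemma tsum_wordSum_past_le (hq : ∑ i, q i = 1) {φ : Flips → ℝ≥0∞} (hφ : IsHittingBound q φ)
    (g : ℕ → ℝ≥0∞) (y : Flips) (J : ℕ) :
    ∑' n, ∑' d, wordSum q (n + d) (fun a =>
      if pos a = 0 ∧ occupation (path a) 0 0 (n + d) = J then
        g (occupation (path a) y d (n + d)) else 0) ≤ φ y * g 0 + φ 0 * ∑' k, g (1 + k) := by
  refine le_trans (ENNReal.tsum_le_tsum fun n => ?_) (tsum_wordSum_visits_le hq hφ g y)
  have e : ∀ d, wordSum q (n + d) (fun a =>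
      if pos a = 0 ∧ occupation (path a) 0 0 (n + d) = J then
        g (occupation (path a) y d (n + d)) else 0) =
      wordSum q n (fun a => g (visits y a) * wordSum q d (fun b =>
        if pos a + pos b = 0 ∧ visits 0 a + visits (pos a) b = J then 1 else 0)) := by
    intro d
    have e1 : wordSum q (n + d) (fun a =>
      if pos a = 0 ∧ occupation (path a) 0 0 (n + d) = J then
        g (occupation (path a) y d (n + d)) else 0) = wordSum q (n + d) (fun a =>
      if pos a.reverse = 0 ∧ visits 0 a.reverse = J then
        g (visits y (a.reverse.take n)) else 0) := by
      refine wordSum_congr fun a ha => ?_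
      rw [pos_reverse]
      by_cases h0 : pos a = 0
      · have h1 : occupation (path a) 0 0 (n + d) = visits 0 a.reverse := by
          have := occupation_path_eq_visits (n := n + d) (d := 0) ha h0 0
          rw [add_zero] at this
          rw [this, List.take_of_length_le (by simp [ha])]
        rw [h1, occupation_path_eq_visits ha h0]
      · simp [h0]
    rw [e1, wordSum_reverse (n + d)
      (fun a => if pos a = 0 ∧ visits 0 a = J then g (visits y (a.take n)) else 0),
      wordSum_append]
    refine wordSum_congr fun a ha => ?_
    rw [← wordSum_const_mul]
    refine wordSum_congr fun b _ => ?_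
    rw [pos_append, visits_append, zero_add, List.take_append_of_le_length ha.ge,
      List.take_of_length_le ha.le]
    split_ifs <;> simp
  simp_rw [e]
  rw [← wordSum_tsum]
  refine wordSum_mono fun a _ => ?_
  rw [ENNReal.tsum_mul_left]
  calc _ ≤ g (visits y a) * 1 := by
        gcongr
        exact tsum_wordSum_return_le_one hq (pos a) (visits 0 a) J
    _ = _ := mul_one _

end WordSum

/-- The walk on `(ℤ/2)³` has bounded expected hitting times; the bound depends on the Hamming
distance to `0` only. -/
lemma exists_isHittingBound {p : Fin 3 → ℝ} (hp : IsWeight p) :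
    ∃ φ : Flips → ℝ≥0∞, (∀ y, φ y ≠ ∞) ∧ IsHittingBound (fun i => ENNReal.ofReal (p i)) φ := by
  obtain ⟨k₀, -, hk₀⟩ := Finset.exists_min_image Finset.univ p ⟨0, Finset.mem_univ 0⟩
  set m := p k₀ with hm
  have hm0 : 0 < m := hp.1 k₀
  have hmle : ∀ i, m ≤ p i := fun i => hk₀ i (Finset.mem_univ i)
  have hsum : p 0 + p 1 + p 2 = 1 := by rw [← hp.2, Fin.sum_univ_three]
  have hpi : ∀ i, p i ≤ 1 - 2 * m := by
    intro i
    have h0 := hmle 0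
    have h1 := hmle 1
    have h2 := hmle 2
    fin_cases i <;> simp <;> linarith
  let K : ℝ := 1 / m
  let a1 : ℝ := (1 + K) / m
  have hK : K * m = 1 := by simp only [K]; field_simp
  have ha1 : a1 * m = 1 + K := by simp only [a1]; field_simp
  have hK0 : 0 < K := by positivity
  have ha0 : 0 < a1 := by positivity
  -- `A d` bounds the hitting time from Hamming distance `d`, and `A 0` the return time.
  let A : ℕ → ℝ := fun d => if d = 0 then 1 + a1 else if d = 1 then a1 else
    if d = 2 then a1 + K else a1 + K + 1
  have hA0 : ∀ d, 0 ≤ A d := by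
    intro d
    simp only [A]
    split_ifs <;> positivity
  let φ : Flips → ℝ := fun y => A ((Finset.univ.filter (fun i => y i ≠ 0)).card)
  refine ⟨fun y => ENNReal.ofReal (φ y), fun y => ENNReal.ofReal_ne_top, ?_⟩
  have key : ∀ y, 1 + ∑ i, p i * (if y + single i = 0 then 0 else φ (y + single i)) ≤ φ y := by
    have hdec : ∀ y : Flips, y = ![y 0, y 1, y 2] := by
      intro y; ext i; fin_cases i <;> rfl
    have h01 : ∀ a : ZMod 2, a = 0 ∨ a = 1 := by decide
    have h0 := hmle 0
    have h1 := hmle 1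
    have h2 := hmle 2
    have g0 := hpi 0
    have g1 := hpi 1
    have g2 := hpi 2
    intro y
    have hd : ∀ (i : Fin 3) (d : ℕ),
        (Finset.univ.filter (fun j => (y + single i) j ≠ 0)).card = d →
        (if y + single i = 0 then 0 else φ (y + single i)) = if d = 0 then 0 else A d := by
      rintro i d rfl
      by_cases hz : y + single i = 0
      · rw [hz]; simp
      · rw [if_neg hz, if_neg]
        simpa [Finset.filter_eq_empty_iff, funext_iff] using hz
    have hd' : ∀ (d : ℕ),
        (Finset.univ.filter (fun j => y j ≠ 0)).card = d → φ y = A d := by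
      rintro d rfl; rfl
    rw [Fin.sum_univ_three]
    rw [hdec y] at hd hd' ⊢
    rcases h01 (y 0) with e0 | e0 <;> rcases h01 (y 1) with e1 | e1 <;>
      rcases h01 (y 2) with e2 | e2 <;> rw [e0, e1, e2] at hd hd' ⊢
    all_goals
      first | rw [hd 0 0 (by decide)] | rw [hd 0 1 (by decide)] | rw [hd 0 2 (by decide)] |
        rw [hd 0 3 (by decide)]
      first | rw [hd 1 0 (by decide)] | rw [hd 1 1 (by decide)] | rw [hd 1 2 (by decide)] |
        rw [hd 1 3 (by decide)]
      first | rw [hd 2 0 (by decide)] | rw [hd 2 1 (by decide)] | rw [hd 2 2 (by decide)] |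
        rw [hd 2 3 (by decide)]
      first | rw [hd' 0 (by decide)] | rw [hd' 1 (by decide)] | rw [hd' 2 (by decide)] |
        rw [hd' 3 (by decide)]
      norm_num [A]
      nlinarith [mul_nonneg hK0.le (sub_nonneg.2 h0), mul_nonneg hK0.le (sub_nonneg.2 h1),
        mul_nonneg hK0.le (sub_nonneg.2 h2), mul_nonneg ha0.le (sub_nonneg.2 h0),
        mul_nonneg ha0.le (sub_nonneg.2 h1), mul_nonneg ha0.le (sub_nonneg.2 h2),
        mul_nonneg hK0.le (sub_nonneg.2 g0), mul_nonneg hK0.le (sub_nonneg.2 g1),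
        mul_nonneg hK0.le (sub_nonneg.2 g2), mul_pos hK0 hm0]
  intro y
  have h := ENNReal.ofReal_le_ofReal (key y)
  rw [ENNReal.ofReal_add zero_le_one, ENNReal.ofReal_one, ENNReal.ofReal_sum_of_nonneg] at h
  · refine le_trans (le_of_eq ?_) h
    congr 1
    refine Finset.sum_congr rfl fun i _ => ?_
    rw [ENNReal.ofReal_mul (hp.1 i).le]
    split_ifs <;> simp
  · intro i _
    have := (hp.1 i).le
    split_ifs
    · simp
    · exact mul_nonneg this (hA0 _)
  · refine Finset.sum_nonneg fun i _ => ?_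
    have := (hp.1 i).le
    split_ifs
    · simp
    · exact mul_nonneg this (hA0 _)

/-! ### Velocities and the law of the impact vectors -/

section Velocity
variable {p : Fin 3 → ℝ} {v₀ v : Space}

/-- The velocity obtained from `v₀` by changing the signs of the coordinates marked by `x`. -/
def vel (v₀ : Space) (x : Flips) : Space := WithLp.toLp 2 (fun i => sgn x i * v₀ i)

@[simp] lemma vel_apply (v₀ : Space) (x : Flips) (i : Fin 3) : vel v₀ x i = sgn x i * v₀ i := rfl

lemma flip_apply (i j : Fin 3) (v : Space) : flip i v j = if j = i then -v j else v j := rfl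

lemma vel_zero (v₀ : Space) : vel v₀ 0 = v₀ := by
  ext i; simp [sgn]

lemma flip_vel (v₀ : Space) (x : Flips) (i : Fin 3) :
    flip i (vel v₀ x) = vel v₀ (x + single i) := by
  ext j
  rw [flip_apply, vel_apply, vel_apply, sgn_add_single]
  split_ifs <;> ring

lemma ne_zero_of_mem_velocities (hp : IsWeight p) (hv : v ∈ velocities p) (i : Fin 3) :
    v i ≠ 0 := by
  have h := hv.2 i
  rw [← abs_pos, h]
  have h1 : 0 < ∑ j, p j ^ 2 :=
    Finset.sum_pos (fun j _ => pow_pos (hp.1 j) 2) ⟨0, Finset.mem_univ 0⟩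
  exact div_pos (hp.1 i) (Real.sqrt_pos.2 h1)

lemma vel_injective (h0 : ∀ i, v₀ i ≠ 0) : Function.Injective (vel v₀) := by
  intro x y hxy
  ext i
  have h1 : sgn x i * v₀ i = sgn y i * v₀ i := by
    rw [← vel_apply, ← vel_apply, hxy]
  have h2 := mul_right_cancel₀ (h0 i) h1
  have key : ∀ a b : ZMod 2, (a = 0 ↔ b = 0) → a = b := by decide
  apply key
  unfold sgn at h2
  by_cases hx : x i = 0 <;> by_cases hy : y i = 0 <;> simp [hx, hy] at h2 ⊢ <;> norm_num at h2

lemma vel_ne_zero (h0 : ∀ i, v₀ i ≠ 0) (x : Flips) (i : Fin 3) : vel v₀ x i ≠ 0 := by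
  rw [vel_apply]
  refine mul_ne_zero ?_ (h0 i)
  unfold sgn
  split_ifs <;> norm_num

lemma jump_vel (h0 : ∀ i, v₀ i ≠ 0) (p : Fin 3 → ℝ) (x : Flips) (i : Fin 3) :
    jump p (vel v₀ x) {vel v₀ (x + single i)} = ENNReal.ofReal (p i) := by
  unfold jump
  rw [Measure.finsetSum_apply, Finset.sum_eq_single i]
  · rw [flip_vel]
    simp
  · intro j _ hji
    rw [flip_vel, Measure.smul_apply, Measure.dirac_apply' _ (MeasurableSet.singleton _)]
    have : vel v₀ (x + single j) ≠ vel v₀ (x + single i) := by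
      intro h
      exact hji (single_injective (add_left_cancel (vel_injective h0 h)))
    simp [this]
  · simp

end Velocity

section Impact

lemma isClosed_cube (r : ℝ) : IsClosed (cube r) := by
  have : cube r = ⋂ i, {x : Space | |x i| ≤ r / 2} := by ext; simp [cube]
  rw [this]
  exact isClosed_iInter fun i => isClosed_le (by fun_prop) continuous_const

lemma mem_frontier_cube {r : ℝ} (hr : 0 < r) {x : Space} (hx : x ∈ cube r) {k : Fin 3}
    (hk : |x k| = r / 2) : x ∈ frontier (cube r) := by
  rw [(isClosed_cube r).frontier_eq]
  refine ⟨hx, fun hint => ?_⟩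
  have hc : Tendsto (fun t : ℝ => t • x) (𝓝[>] 1) (𝓝 x) := by
    have : Tendsto (fun t : ℝ => t • x) (𝓝 1) (𝓝 ((1 : ℝ) • x)) := by
      apply Continuous.tendsto; fun_prop
    rw [one_smul] at this
    exact this.mono_left nhdsWithin_le_nhds
  obtain ⟨t, ht, ht1⟩ :=
    ((hc.eventually (mem_interior_iff_mem_nhds.1 hint)).and self_mem_nhdsWithin).exists
  have h1 := ht k
  simp only [PiLp.smul_apply, smul_eq_mul, abs_mul, hk] at h1
  have h2 : (1 : ℝ) < |t| := lt_of_lt_of_le ht1 (le_abs_self t)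
  nlinarith

variable {r : ℝ} {v : Space} {k : Fin 3}

lemma flip_inj (hv : ∀ i, v i ≠ 0) {i j : Fin 3} (h : flip i v = flip j v) : i = j := by
  by_contra hne
  have h1 : flip i v i = flip j v i := by rw [h]
  rw [flip_apply, flip_apply, if_pos rfl, if_neg hne] at h1
  exact hv i (by linarith)

lemma face_subset_cube (r : ℝ) (v w : Space) : face r v w ⊆ cube r :=
  fun _ hb => (isClosed_cube r).frontier_subset hb.1

/-- The reflected face, a square of side `r`, has positive and finite area. -/
lemma hausdorffMeasure_face (hr : 0 < r) (hv : ∀ i, v i ≠ 0) (k : Fin 3) :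
    Measure.hausdorffMeasure 2 {b : Space | -b ∈ face r v (flip k v)} ≠ 0 ∧
      Measure.hausdorffMeasure 2 {b : Space | -b ∈ face r v (flip k v)} ≠ ∞ := by
  set s := {b : Space | -b ∈ face r v (flip k v)} with hs
  let c : ℝ := v k / |v k| * (r / 2)
  have hc : |c| = r / 2 := by
    have : 0 < |v k| := abs_pos.2 (hv k)
    rw [abs_mul, abs_div, abs_abs, div_self this.ne', one_mul, abs_of_pos (by positivity)]
  let box : Set (Fin 2 → ℝ) := Set.Icc (fun _ => -(r / 2)) (fun _ => r / 2)
  let f : (Fin 2 → ℝ) → Space := fun z => WithLp.toLp 2 (Fin.insertNth (α := fun _ => ℝ) k c z)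
  let g : Space → (Fin 2 → ℝ) := fun b j => b (k.succAbove j)
  have hvol : (Measure.hausdorffMeasure 2 : Measure (Fin 2 → ℝ)) = volume := by
    have := hausdorffMeasure_pi_real (ι := Fin 2)
    simpa using this
  have hfs : ∀ z ∈ box, f z ∈ s := by
    intro z hz
    have hk : f z k = c := by simp [f]
    have hcube : -f z ∈ cube r := by
      intro i
      rw [PiLp.neg_apply, abs_neg]
      rcases Fin.eq_self_or_eq_succAbove k i with rfl | ⟨j, rfl⟩
      · rw [hk, hc]
      · have : f z (k.succAbove j) = z j := by simp [f]
        rw [this]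
        exact abs_le.2 ⟨hz.1 j, hz.2 j⟩
    refine ⟨mem_frontier_cube hr hcube (k := k) ?_, k, rfl, ?_⟩
    · rw [PiLp.neg_apply, abs_neg, hk, hc]
    · rw [PiLp.neg_apply, hk]
      simp [c]
  have hg : LipschitzWith 1 g := by
    refine LipschitzWith.of_dist_le_mul fun a b => ?_
    rw [NNReal.coe_one, one_mul, dist_pi_le_iff dist_nonneg]
    intro j
    rw [dist_eq_norm, dist_eq_norm]
    exact PiLp.norm_apply_le (a - b) (k.succAbove j)
  constructor
  · intro h0
    have h1 : box ⊆ g '' s := by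
      intro z hz
      refine ⟨f z, hfs z hz, ?_⟩
      ext j
      simp [f, g]
    have h2 := (measure_mono h1).trans
      (hg.hausdorffMeasure_image_le (d := 2) (by norm_num) s)
    rw [h0, mul_zero, hvol, Real.volume_Icc_pi] at h2
    simp at h2
    linarith
  · have h1 : s ⊆ f '' box := by
      rintro b ⟨hb, k', hk', hbk⟩
      obtain rfl := flip_inj hv hk'
      have hbc := (isClosed_cube r).frontier_subset hb
      refine ⟨g b, ⟨fun j => ?_, fun j => ?_⟩, ?_⟩
      · have := abs_le.1 (hbc (k.succAbove j))
        simp only [PiLp.neg_apply] at this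
        simp only [g]; linarith
      · have := abs_le.1 (hbc (k.succAbove j))
        simp only [PiLp.neg_apply] at this
        simp only [g]; linarith
      · ext i
        rcases Fin.eq_self_or_eq_succAbove k i with rfl | ⟨j, rfl⟩
        · rw [PiLp.neg_apply] at hbk
          simp only [f, Fin.insertNth_apply_same, c]
          linarith
        · simp [f, g]
    have hf1 : LipschitzWith 1 (fun z : Fin 2 → ℝ => (Fin.insertNth (α := fun _ => ℝ) k c z)) := by
      refine LipschitzWith.of_dist_le_mul fun a b => ?_
      rw [NNReal.coe_one, one_mul, dist_pi_le_iff dist_nonneg]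
      intro i
      rcases Fin.eq_self_or_eq_succAbove k i with rfl | ⟨j, rfl⟩
      · simp
      · simpa using dist_le_pi_dist a b j
    have hf := (PiLp.lipschitzWith_toLp (p := 2) (fun _ : Fin 3 => ℝ)).comp hf1
    have h2 := (measure_mono h1).trans
      (hf.hausdorffMeasure_image_le (d := 2) (by norm_num) box)
    refine ne_top_of_le_ne_top ?_ h2
    rw [hvol, Real.volume_Icc_pi]
    refine ENNReal.mul_ne_top (ENNReal.rpow_ne_top_of_nonneg (by norm_num) ENNReal.coe_ne_top) ?_
    exact ENNReal.prod_ne_top fun _ _ => ENNReal.ofReal_ne_top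

lemma impactLaw_univ (hr : 0 < r) (hv : ∀ i, v i ≠ 0) (k : Fin 3) :
    impactLaw r v (flip k v) Set.univ = 1 := by
  obtain ⟨h0, h1⟩ := hausdorffMeasure_face hr hv k
  rw [impactLaw, cond_apply' MeasurableSet.univ, Set.inter_univ, ENNReal.inv_mul_cancel h0 h1]

lemma impactLaw_compl_cube (r : ℝ) (v w : Space) : impactLaw r v w (cube r)ᶜ = 0 := by
  rw [impactLaw, cond_apply' (isClosed_cube r).measurableSet.compl]
  have : {b : Space | -b ∈ face r v w} ∩ (cube r)ᶜ = ∅ := by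
    ext b
    simp only [Set.mem_inter_iff, Set.mem_compl_iff, Set.mem_empty_iff_false, iff_false, not_and,
      not_not]
    intro hb i
    have := face_subset_cube r v w hb i
    rwa [PiLp.neg_apply, abs_neg] at this
  rw [this, measure_empty, mul_zero]

end Impact

/-! ### The law of the flight data along a word -/

section FlightData
variable {p : Fin 3 → ℝ} {v₀ : Space} {r : ℝ} {S : Type u} [MeasurableSpace S] {P : Measure S}
  {u : ℕ → S → Space} {ξ : ℕ → S → ℝ} {β : ℕ → S → Space}

/-- The law of a single letter. -/
def letter (p : Fin 3 → ℝ) (i : Fin 3) : ℝ≥0∞ := ENNReal.ofReal (p i)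

/-- The probability of a word. -/
def weight (p : Fin 3 → ℝ) (w : List (Fin 3)) : ℝ≥0∞ := (w.map (letter p)).prod

lemma sum_letter (hp : IsWeight p) : ∑ i, letter p i = 1 := by
  unfold letter
  rw [← ENNReal.ofReal_sum_of_nonneg fun i _ => (hp.1 i).le, hp.2, ENNReal.ofReal_one]

lemma weight_concat (p : Fin 3 → ℝ) (w : List (Fin 3)) (i : Fin 3) :
    weight p (w ++ [i]) = weight p w * letter p i := by
  simp [weight]

lemma weight_ne_zero (hp : IsWeight p) (w : List (Fin 3)) : weight p w ≠ 0 := by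
  induction w with
  | nil => simp [weight]
  | cons i w ih =>
    have : letter p i ≠ 0 := by simpa [letter] using hp.1 i
    simpa [weight, this] using ih

lemma weight_ne_top (p : Fin 3 → ℝ) (w : List (Fin 3)) : weight p w ≠ ∞ := by
  induction w with
  | nil => simp [weight]
  | cons i w ih =>
    have : letter p i ≠ ∞ := ENNReal.ofReal_ne_top
    simpa [weight] using ENNReal.mul_ne_top this ih

lemma weight_eq_prod (p : Fin 3 → ℝ) (w : List (Fin 3)) :
    weight p w = ∏ l ∈ Finset.range w.length, letter p (w.getD l 0) := by
  induction w with
  | nil => rfl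
  | cons i w ih =>
    rw [List.length_cons, Finset.prod_range_succ']
    simp only [List.getD_cons_succ, List.getD_cons_zero]
    rw [← ih, mul_comm]
    simp [weight]

/-- The event that the velocities follow the path driven by the word `w`. -/
def followEvent (v₀ : Space) (u : ℕ → S → Space) (w : List (Fin 3)) : Set S :=
  {ω | ∀ l ≤ w.length, u (l + 1) ω = vel v₀ (path w l)}

lemma prod_Icc_one {M : Type*} [CommMonoid M] (f : ℕ → M) (n : ℕ) :
    ∏ i ∈ Finset.Icc 1 n, f i = ∏ l ∈ Finset.range n, f (l + 1) := by
  induction n with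
  | zero => simp
  | succ n ih => rw [Finset.prod_Icc_succ_top (by omega), ih, Finset.prod_range_succ]

lemma IsFlightData.measurableSet_followEvent (h : IsFlightData p v₀ r P u ξ β)
    (w : List (Fin 3)) : MeasurableSet (followEvent v₀ u w) := by
  have : followEvent v₀ u w = ⋂ l, ⋂ (_ : l ≤ w.length), u (l + 1) ⁻¹' {vel v₀ (path w l)} := by
    ext; simp [followEvent]
  rw [this]
  exact MeasurableSet.iInter fun l => MeasurableSet.iInter fun _ =>
    h.measurable_u _ (measurableSet_singleton _)

/-- The law of the data along a word, with the velocity before time `0` fixed. -/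
lemma IsFlightData.measure_word (h : IsFlightData p v₀ r P u ξ β) (h0 : ∀ i, v₀ i ≠ 0)
    (i₀ : Fin 3) (w : List (Fin 3)) (A : ℕ → Set ℝ) (D : ℕ → Set Space)
    (hA : ∀ i, MeasurableSet (A i)) (hD : ∀ i, MeasurableSet (D i)) :
    ∃ W : ℕ → Space, (∀ i, ∃ x k, W i = vel v₀ x ∧ (i ≤ w.length → W (i + 1) = flip k (W i))) ∧
    P ({ω | u 0 ω = vel v₀ (single i₀)} ∩ followEvent v₀ u w ∩
        {ω | ∀ l < w.length, ξ (l + 1) ω ∈ A l} ∩ {ω | ∀ i ≤ w.length, β i ω ∈ D i}) =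
      P {ω | u 0 ω = vel v₀ (single i₀) ∧ u 1 ω = v₀} * weight p w *
        (∏ l ∈ Finset.range w.length, expMeasure 1 (A l)) *
        ∏ i ∈ Finset.Icc 0 w.length, impactLaw r (W i) (W (i + 1)) (D i) := by
  let W : ℕ → Space := fun i => if i = 0 then vel v₀ (single i₀) else vel v₀ (path w (i - 1))
  have hW : ∀ l, W (l + 1) = vel v₀ (path w l) := by intro l; simp [W]
  have hstep : ∀ l, l < w.length → path w (l + 1) = path w l + single (w.getD l 0) := by
    intro l hl
    rw [path_succ hl, List.getD_eq_getElem _ _ hl]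
  refine ⟨W, ?_, ?_⟩
  · intro i
    rcases Nat.eq_zero_or_pos i with rfl | hi
    · refine ⟨single i₀, i₀, by simp [W], fun _ => ?_⟩
      have : W 0 = vel v₀ (single i₀) := by simp [W]
      rw [hW, this, flip_vel, flips_add_self]
      simp [path]
    · obtain ⟨l, rfl⟩ : ∃ l, i = l + 1 := ⟨i - 1, by omega⟩
      refine ⟨path w l, w.getD l 0, hW l, fun hl => ?_⟩
      rw [hW, hW, flip_vel, hstep l (by omega)]
  · have key := h.law w.length W (fun i => A (i - 1)) D (fun i => hA _) hD
    rw [prod_Icc_one, prod_Icc_one] at key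
    have e1 : {ω | u 0 ω = W 0 ∧ u 1 ω = W 1} =
        {ω | u 0 ω = vel v₀ (single i₀) ∧ u 1 ω = v₀} := by
      have : W 1 = v₀ := by rw [hW 0]; simp [path, vel_zero]
      rw [this]; simp [W]
    have e2 : ∏ l ∈ Finset.range w.length, jump p (W (l + 1)) {W (l + 1 + 1)} = weight p w := by
      rw [weight_eq_prod]
      refine Finset.prod_congr rfl fun l hl => ?_
      rw [hW, hW, hstep l (Finset.mem_range.1 hl), jump_vel h0]
      rfl
    rw [e1, e2] at key
    simp only [Nat.add_sub_cancel] at key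
    rw [← key]
    congr 1
    ext ω
    simp only [Set.mem_inter_iff, followEvent, Finset.mem_Icc]
    constructor
    · rintro ⟨⟨⟨a, b⟩, c⟩, d⟩
      refine ⟨fun i hi => ?_, fun i hi => ?_, fun i hi => d i hi.2⟩
      · rcases Nat.eq_zero_or_pos i with rfl | hi'
        · simpa [W] using a
        · obtain ⟨l, rfl⟩ : ∃ l, i = l + 1 := ⟨i - 1, by omega⟩
          rw [hW]; exact b l (by omega)
      · have := c (i - 1) (by omega)
        rwa [Nat.sub_add_cancel hi.1] at this
    · rintro ⟨a, b, c⟩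
      refine ⟨⟨⟨?_, fun l hl => ?_⟩, fun l hl => ?_⟩, fun i hi => c i ⟨Nat.zero_le _, hi⟩⟩
      · simpa [W] using a 0 (by omega)
      · rw [← hW]; exact a (l + 1) (by omega)
      · exact b (l + 1) (by omega)

end FlightData

/-! ### Conditioning on the path of velocities -/

section FlightData
variable {p : Fin 3 → ℝ} {v₀ : Space} {r : ℝ} {S : Type u} [MeasurableSpace S] {P : Measure S}
  {u : ℕ → S → Space} {ξ : ℕ → S → ℝ} {β : ℕ → S → Space}

lemma measure_eq_sum_of_ae_mem {ι : Type*} [Fintype ι] {C : ι → Set S}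
    (hC : ∀ i, MeasurableSet (C i)) (hd : Pairwise (fun i j => Disjoint (C i) (C j)))
    {B : Set S} (hB : MeasurableSet B) (hae : ∀ᵐ ω ∂P, ω ∈ B → ∃ i, ω ∈ C i) :
    P B = ∑ i, P (C i ∩ B) := by
  have h1 : P B = P (⋃ i, C i ∩ B) := by
    apply measure_congr
    filter_upwards [hae] with ω hω
    refine propext ⟨fun hb => ?_, fun hb => ?_⟩
    · obtain ⟨i, hi⟩ := hω hb
      exact Set.mem_iUnion.2 ⟨i, hi, hb⟩
    · obtain ⟨i, hi⟩ := Set.mem_iUnion.1 hb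
      exact hi.2
  rw [h1, measure_iUnion (fun i j hij => (hd hij).mono Set.inter_subset_left Set.inter_subset_left)
    (fun i => (hC i).inter hB), tsum_fintype]

lemma IsFlightData.measure_eq_sum_initial (h : IsFlightData p v₀ r P u ξ β)
    (h0 : ∀ i, v₀ i ≠ 0) {B : Set S} (hB : MeasurableSet B) :
    P B = ∑ i, P ({ω | u 0 ω = vel v₀ (single i)} ∩ B) := by
  refine measure_eq_sum_of_ae_mem
    (fun i => h.measurable_u 0 (measurableSet_singleton _)) ?_ hB ?_
  · intro i j hij
    rw [Set.disjoint_left]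
    intro ω hi hj
    exact hij (single_injective (vel_injective h0 (hi.symm.trans hj)))
  · filter_upwards [h.u_zero] with ω hω _
    obtain ⟨-, i, hi⟩ := hω
    refine ⟨i, ?_⟩
    change u 0 ω = _
    rw [hi, ← zero_add (single i), ← flip_vel, vel_zero]

lemma IsFlightData.measure_follow_inter [IsProbabilityMeasure P]
    (h : IsFlightData p v₀ r P u ξ β) (h0 : ∀ i, v₀ i ≠ 0) (hr : 0 < r) (w : List (Fin 3))
    (A : ℕ → Set ℝ) (hA : ∀ i, MeasurableSet (A i)) :
    P (followEvent v₀ u w ∩ {ω | ∀ l < w.length, ξ (l + 1) ω ∈ A l}) =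
      weight p w * ∏ l ∈ Finset.range w.length, expMeasure 1 (A l) := by
  have hm : MeasurableSet (followEvent v₀ u w ∩ {ω | ∀ l < w.length, ξ (l + 1) ω ∈ A l}) := by
    refine (h.measurableSet_followEvent w).inter ?_
    have : {ω | ∀ l < w.length, ξ (l + 1) ω ∈ A l} =
        ⋂ l, ⋂ (_ : l < w.length), ξ (l + 1) ⁻¹' A l := by ext; simp
    rw [this]
    exact MeasurableSet.iInter fun l => MeasurableSet.iInter fun _ => h.measurable_ξ _ (hA l)
  rw [h.measure_eq_sum_initial h0 hm]
  have key : ∀ i, P ({ω | u 0 ω = vel v₀ (single i)} ∩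
      (followEvent v₀ u w ∩ {ω | ∀ l < w.length, ξ (l + 1) ω ∈ A l})) =
      P ({ω | u 0 ω = vel v₀ (single i)} ∩ {ω | u 1 ω = v₀}) *
        (weight p w * ∏ l ∈ Finset.range w.length, expMeasure 1 (A l)) := by
    intro i
    obtain ⟨W, hW, e⟩ := h.measure_word h0 i w A (fun _ => Set.univ) hA
      (fun _ => MeasurableSet.univ)
    have e1 : ∏ i ∈ Finset.Icc 0 w.length, impactLaw r (W i) (W (i + 1)) Set.univ = 1 := by
      refine Finset.prod_eq_one fun i hi => ?_
      obtain ⟨x, k, hx, hk⟩ := hW i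
      rw [hk (Finset.mem_Icc.1 hi).2]
      exact impactLaw_univ hr (by rw [hx]; exact vel_ne_zero h0 x) k
    rw [e1] at e
    simp only [Set.mem_univ, implies_true, Set.inter_assoc, mul_one] at e
    have e2 : {_ω : S | True} = Set.univ := by ext; simp
    rw [e2, Set.inter_univ, mul_assoc] at e
    exact e
  simp_rw [key]
  have h1 : MeasurableSet {ω | u 1 ω = v₀} := h.measurable_u 1 (measurableSet_singleton _)
  rw [← Finset.sum_mul, ← h.measure_eq_sum_initial h0 h1]
  have : P {ω | u 1 ω = v₀} = 1 := (prob_compl_eq_zero_iff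
    (h.measurable_u 1 (measurableSet_singleton _))).1 h.u_one
  rw [this, one_mul]

lemma IsFlightData.measure_follow [IsProbabilityMeasure P]
    (h : IsFlightData p v₀ r P u ξ β) (h0 : ∀ i, v₀ i ≠ 0) (hr : 0 < r) (w : List (Fin 3)) :
    P (followEvent v₀ u w) = weight p w := by
  have := h.measure_follow_inter h0 hr w (fun _ => Set.univ) (fun _ => MeasurableSet.univ)
  have hE : IsProbabilityMeasure (expMeasure 1) := isProbabilityMeasure_expMeasure one_pos
  simpa using this

lemma followEvent_append_subset {S : Type*} (v₀ : Space) (u : ℕ → S → Space) (a b : List (Fin 3)) :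
    followEvent v₀ u (a ++ b) ⊆ followEvent v₀ u a := by
  intro ω hω l hl
  rw [hω l (by simp; omega), path_append hl]

lemma disjoint_followEvent {S : Type*} {u : ℕ → S → Space} (h0 : ∀ i, v₀ i ≠ 0)
    (w : List (Fin 3)) {i j : Fin 3} (hij : i ≠ j) :
    Disjoint (followEvent v₀ u (w ++ [i])) (followEvent v₀ u (w ++ [j])) := by
  rw [Set.disjoint_left]
  intro ω hi hj
  have h1 := hi (w.length + 1) (by simp)
  have h2 := hj (w.length + 1) (by simp)
  have h3 := vel_injective h0 (h1.symm.trans h2)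
  have e : ∀ k, path (w ++ [k]) (w.length + 1) = pos w + single k := by
    intro k
    rw [path, List.take_of_length_le (by simp), pos_append]
    simp
  rw [e, e] at h3
  exact hij (single_injective (add_left_cancel h3))

lemma IsFlightData.ae_follow_concat [IsProbabilityMeasure P]
    (h : IsFlightData p v₀ r P u ξ β) (hp : IsWeight p) (h0 : ∀ i, v₀ i ≠ 0) (hr : 0 < r)
    (w : List (Fin 3)) :
    ∀ᵐ ω ∂P, ω ∈ followEvent v₀ u w → ∃ i, ω ∈ followEvent v₀ u (w ++ [i]) := by
  have hm := fun w => h.measurableSet_followEvent w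
  have hsub : (⋃ i, followEvent v₀ u (w ++ [i])) ⊆ followEvent v₀ u w :=
    Set.iUnion_subset fun i => followEvent_append_subset v₀ u w [i]
  have h1 : P (⋃ i, followEvent v₀ u (w ++ [i])) = P (followEvent v₀ u w) := by
    rw [measure_iUnion (fun i j hij => disjoint_followEvent h0 w hij) (fun i => hm _), tsum_fintype]
    simp_rw [h.measure_follow h0 hr, weight_concat]
    rw [← Finset.mul_sum, sum_letter hp, mul_one]
  have h2 : P (followEvent v₀ u w \ ⋃ i, followEvent v₀ u (w ++ [i])) = 0 := by
    rw [measure_sdiff hsub (MeasurableSet.iUnion fun i => hm _).nullMeasurableSet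
      (measure_ne_top _ _), h1, tsub_self]
  filter_upwards [measure_eq_zero_iff_ae_notMem.1 h2] with ω hω hw
  by_contra hcon
  exact hω ⟨hw, fun hu => hcon (Set.mem_iUnion.1 hu)⟩

/-- Almost surely the velocities follow a path of flips from `v₀`. -/
lemma IsFlightData.ae_exists_follow [IsProbabilityMeasure P]
    (h : IsFlightData p v₀ r P u ξ β) (hp : IsWeight p) (h0 : ∀ i, v₀ i ≠ 0) (hr : 0 < r) :
    ∀ᵐ ω ∂P, ∀ n, ∃ w : List (Fin 3), w.length = n ∧ ω ∈ followEvent v₀ u w := by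
  filter_upwards [h.u_one, ae_all_iff.2 (h.ae_follow_concat hp h0 hr)] with ω h1 hω n
  induction n with
  | zero =>
    refine ⟨[], rfl, fun l hl => ?_⟩
    obtain rfl : l = 0 := by simpa using hl
    simp [path, vel_zero, h1]
  | succ n ih =>
    obtain ⟨w, hw, hf⟩ := ih
    obtain ⟨i, hi⟩ := hω w hf
    exact ⟨w ++ [i], by simp [hw], hi⟩

lemma IsFlightData.measure_follow_inter_of_le [IsProbabilityMeasure P]
    (h : IsFlightData p v₀ r P u ξ β) (hp : IsWeight p) (h0 : ∀ i, v₀ i ≠ 0) (hr : 0 < r)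
    (A : ℕ → Set ℝ) (hA : ∀ i, MeasurableSet (A i)) (m : ℕ) (w : List (Fin 3)) :
    P (followEvent v₀ u w ∩ {ω | ∀ l < w.length + m, ξ (l + 1) ω ∈ A l}) =
      weight p w * ∏ l ∈ Finset.range (w.length + m), expMeasure 1 (A l) := by
  induction m generalizing w with
  | zero => exact h.measure_follow_inter h0 hr w A hA
  | succ m ih =>
    have hm : MeasurableSet {ω | ∀ l < w.length + (m + 1), ξ (l + 1) ω ∈ A l} := by
      have : {ω | ∀ l < w.length + (m + 1), ξ (l + 1) ω ∈ A l} =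
          ⋂ l, ⋂ (_ : l < w.length + (m + 1)), ξ (l + 1) ⁻¹' A l := by ext; simp
      rw [this]
      exact MeasurableSet.iInter fun l => MeasurableSet.iInter fun _ => h.measurable_ξ _ (hA l)
    rw [measure_eq_sum_of_ae_mem (C := fun i => followEvent v₀ u (w ++ [i]))
      (fun i => h.measurableSet_followEvent _) (fun i j hij => disjoint_followEvent h0 w hij)
      ((h.measurableSet_followEvent w).inter hm)
      ((h.ae_follow_concat hp h0 hr w).mono fun ω hω hb => hω hb.1)]
    have key : ∀ i, P (followEvent v₀ u (w ++ [i]) ∩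
        (followEvent v₀ u w ∩ {ω | ∀ l < w.length + (m + 1), ξ (l + 1) ω ∈ A l})) =
        weight p w * letter p i *
          ∏ l ∈ Finset.range (w.length + (m + 1)), expMeasure 1 (A l) := by
      intro i
      rw [← Set.inter_assoc, Set.inter_eq_left.2 (followEvent_append_subset v₀ u w [i])]
      have := ih (w ++ [i])
      rw [weight_concat, List.length_append, List.length_singleton, add_assoc, add_comm 1 m] at this
      exact this
    simp_rw [key]
    rw [← Finset.sum_mul, ← Finset.mul_sum, sum_letter hp, mul_one]

/-- The flight times `ξ 1, ξ 2, …`, indexed from `0`. -/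
def duration (ξ : ℕ → S → ℝ) (i : ℕ) : S → ℝ := ξ (i + 1)

/-- The flight times are independent of the velocities: conditioned on a finite part of the path
of velocities, they are still independent standard exponential variables. -/
lemma IsFlightData.isExpSequence_cond [IsProbabilityMeasure P]
    (h : IsFlightData p v₀ r P u ξ β) (hp : IsWeight p) (h0 : ∀ i, v₀ i ≠ 0) (hr : 0 < r)
    (w : List (Fin 3)) : IsExpSequence (P[|followEvent v₀ u w]) (duration ξ) := by
  have hE : IsProbabilityMeasure (expMeasure 1) := isProbabilityMeasure_expMeasure one_pos
  have key : ∀ (F : Finset ℕ) (A : ℕ → Set ℝ), (∀ i ∈ F, MeasurableSet (A i)) →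
      P[|followEvent v₀ u w] (⋂ i ∈ F, duration ξ i ⁻¹' A i) = ∏ i ∈ F, expMeasure 1 (A i) := by
    intro F A hA
    obtain ⟨m, hm⟩ := F.exists_nat_subset_range
    classical
    let A' : ℕ → Set ℝ := fun i => if i ∈ F then A i else Set.univ
    have hA' : ∀ i, MeasurableSet (A' i) := by
      intro i
      by_cases hi : i ∈ F <;> simp [A', hi, hA]
    have e := h.measure_follow_inter_of_le hp h0 hr A' hA' m w
    have e1 : {ω | ∀ l < w.length + m, ξ (l + 1) ω ∈ A' l} = ⋂ i ∈ F, duration ξ i ⁻¹' A i := by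
      ext ω
      simp only [Set.mem_iInter, Set.mem_preimage, duration]
      constructor
      · intro hω i hi
        have := hω i (by have := Finset.mem_range.1 (hm hi); omega)
        simpa [A', hi] using this
      · intro hω l _
        by_cases hl : l ∈ F
        · simpa [A', hl] using hω l hl
        · simp [A', hl]
    have e2 : ∏ l ∈ Finset.range (w.length + m), expMeasure 1 (A' l) =
        ∏ i ∈ F, expMeasure 1 (A i) := by
      rw [← Finset.prod_subset (s₁ := F)]
      · exact Finset.prod_congr rfl fun i hi => by simp [A', hi]
      · exact hm.trans (Finset.range_subset_range.2 (by omega))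
      · intro i _ hi
        simp [A', hi]
    rw [cond_apply (h.measurableSet_followEvent w), ← e1, e, e2, h.measure_follow h0 hr,
      ← mul_assoc, ENNReal.inv_mul_cancel (weight_ne_zero hp w) (weight_ne_top p w), one_mul]
  have hlaw : ∀ (i : ℕ) (A : Set ℝ), MeasurableSet A →
      P[|followEvent v₀ u w] (duration ξ i ⁻¹' A) = expMeasure 1 A := by
    intro i A hA
    simpa using key {i} (fun _ => A) (by simpa using hA)
  refine ⟨fun i => h.measurable_ξ _, ?_, fun i => ?_⟩
  · rw [iIndepFun_iff_measure_inter_preimage_eq_mul]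
    intro F A hA
    rw [key F A hA]
    exact Finset.prod_congr rfl fun i hi => (hlaw i (A i) (hA i hi)).symm
  · ext A hA
    rw [Measure.map_apply (f := duration ξ i) (h.measurable_ξ (i + 1)) hA]
    exact hlaw i A hA

lemma IsFlightData.isProbabilityMeasure_cond [IsProbabilityMeasure P]
    (h : IsFlightData p v₀ r P u ξ β) (hp : IsWeight p) (h0 : ∀ i, v₀ i ≠ 0) (hr : 0 < r)
    (w : List (Fin 3)) : IsProbabilityMeasure (P[|followEvent v₀ u w]) :=
  cond_isProbabilityMeasure (by rw [h.measure_follow h0 hr]; exact weight_ne_zero hp w)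

lemma IsFlightData.measure_follow_inter_eq [IsProbabilityMeasure P]
    (h : IsFlightData p v₀ r P u ξ β) (hp : IsWeight p) (h0 : ∀ i, v₀ i ≠ 0) (hr : 0 < r)
    (w : List (Fin 3)) (H : Set S) :
    P (followEvent v₀ u w ∩ H) = weight p w * P[|followEvent v₀ u w] H := by
  rw [cond_apply (h.measurableSet_followEvent w), h.measure_follow h0 hr, ← mul_assoc,
    ENNReal.mul_inv_cancel (weight_ne_zero hp w) (weight_ne_top p w), one_mul]

/-- Total probability over the first `n` jumps. -/
lemma IsFlightData.measure_le_wordSum [IsProbabilityMeasure P]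
    (h : IsFlightData p v₀ r P u ξ β) (hp : IsWeight p) (h0 : ∀ i, v₀ i ≠ 0) (hr : 0 < r)
    (n : ℕ) (H : Set S) (F : List (Fin 3) → ℝ≥0∞)
    (hF : ∀ w, w.length = n → P (followEvent v₀ u w ∩ H) ≤ weight p w * F w) :
    P H ≤ wordSum (letter p) n F := by
  have key : ∀ (m : ℕ) (a : List (Fin 3)), a.length + m = n → P (followEvent v₀ u a ∩ H) ≤
      weight p a * wordSum (letter p) m (fun b => F (a ++ b)) := by
    intro m
    induction m with
    | zero => intro a ha; simpa [wordSum] using hF a ha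
    | succ m ih =>
      intro a ha
      have h1 : P (followEvent v₀ u a ∩ H) ≤ P (⋃ i, followEvent v₀ u (a ++ [i]) ∩ H) := by
        apply measure_mono_ae
        filter_upwards [h.ae_follow_concat hp h0 hr a] with ω hω hb
        obtain ⟨i, hi⟩ := hω hb.1
        exact Set.mem_iUnion.2 ⟨i, hi, hb.2⟩
      refine h1.trans ((measure_iUnion_le _).trans ?_)
      rw [tsum_fintype, wordSum, Finset.mul_sum]
      refine Finset.sum_le_sum fun i _ => ?_
      refine (ih (a ++ [i]) (by simp; omega)).trans (le_of_eq ?_)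
      rw [weight_concat, mul_assoc]
      simp
  have := key n [] (by simp)
  have e : P H = P (followEvent v₀ u [] ∩ H) := by
    apply measure_congr
    filter_upwards [h.ae_exists_follow hp h0 hr] with ω hω
    obtain ⟨w, hw, hf⟩ := hω 0
    rw [List.length_eq_zero_iff] at hw
    subst hw
    exact propext ⟨fun hb => ⟨hf, hb⟩, fun hb => hb.2⟩
  rw [e]
  simpa [weight] using this

/-- The impact vectors lie on the boundary of the cube. -/
lemma IsFlightData.ae_mem_cube [IsProbabilityMeasure P]
    (h : IsFlightData p v₀ r P u ξ β) (hp : IsWeight p) (h0 : ∀ i, v₀ i ≠ 0) (hr : 0 < r) :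
    ∀ᵐ ω ∂P, ∀ k, β k ω ∈ cube r := by
  rw [ae_all_iff]
  intro k
  have hnull : ∀ (w : List (Fin 3)), w.length = k → ∀ i₀ : Fin 3,
      P ({ω | u 0 ω = vel v₀ (single i₀)} ∩ followEvent v₀ u w ∩ {ω | β k ω ∉ cube r}) = 0 := by
    intro w hw i₀
    classical
    obtain ⟨W, -, e⟩ := h.measure_word h0 i₀ w (fun _ => Set.univ)
      (fun i => if i = k then (cube r)ᶜ else Set.univ) (fun _ => MeasurableSet.univ)
      (fun i => by
        split_ifs
        · exact (isClosed_cube r).measurableSet.compl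
        · exact MeasurableSet.univ)
    have e1 : ∏ i ∈ Finset.Icc 0 w.length, impactLaw r (W i) (W (i + 1))
        (if i = k then (cube r)ᶜ else Set.univ) = 0 :=
      Finset.prod_eq_zero (i := k) (by simp [hw])
        (by rw [if_pos rfl]; exact impactLaw_compl_cube _ _ _)
    rw [e1, mul_zero] at e
    refine measure_mono_null ?_ e
    rintro ω ⟨hω, hk⟩
    refine ⟨⟨hω, fun _ _ => trivial⟩, fun i _ => ?_⟩
    by_cases hi : i = k
    · subst hi; simpa using hk
    · simp [hi]
  have hnull' : P (⋃ w : {w : List (Fin 3) // w.length = k}, ⋃ i₀ : Fin 3,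
      {ω | u 0 ω = vel v₀ (single i₀)} ∩ followEvent v₀ u w ∩ {ω | β k ω ∉ cube r}) = 0 :=
    measure_iUnion_null fun w => measure_iUnion_null fun i₀ => hnull w w.2 i₀
  filter_upwards [measure_eq_zero_iff_ae_notMem.1 hnull', h.u_zero, h.ae_exists_follow hp h0 hr]
    with ω hω h1 h2
  by_contra hcon
  obtain ⟨w, hw, hf⟩ := h2 k
  obtain ⟨-, i, hi⟩ := h1
  refine hω (Set.mem_iUnion.2 ⟨⟨w, hw⟩, Set.mem_iUnion.2 ⟨i, ⟨?_, hf⟩, hcon⟩⟩)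
  rw [Set.mem_ofPred_eq, hi, ← zero_add (single i), ← flip_vel, vel_zero]

end FlightData

/-! ### Pathwise analysis of mismatches -/

section Pathwise
variable {u : ℕ → Space} {ξ : ℕ → ℝ} {β : ℕ → Space} {r : ℝ} {v₀ : Space}

lemma sum_Icc_one_eq {M : Type*} [AddCommMonoid M] (f : ℕ → M) (n : ℕ) :
    ∑ i ∈ Finset.Icc 1 n, f i = ∑ l ∈ Finset.range n, f (l + 1) := by
  induction n with
  | zero => simp
  | succ n ih => rw [Finset.sum_Icc_succ_top (by omega), ih, Finset.sum_range_succ]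

lemma scatterTime_zero (ξ : ℕ → ℝ) : scatterTime ξ 0 = 0 := by simp [scatterTime]

lemma scatterTime_succ (ξ : ℕ → ℝ) (n : ℕ) :
    scatterTime ξ (n + 1) = scatterTime ξ n + ξ (n + 1) := by
  rw [scatterTime, Finset.sum_Icc_succ_top (by omega)]; rfl

lemma position_succ (u : ℕ → Space) (ξ : ℕ → ℝ) (n : ℕ) :
    position u ξ (n + 1) = position u ξ n + ξ (n + 1) • u (n + 1) := by
  rw [position, Finset.sum_Icc_succ_top (by omega)]; rfl

lemma position_sub_position (u : ℕ → Space) (ξ : ℕ → ℝ) {a b : ℕ} (hab : a ≤ b) :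
    position u ξ b - position u ξ a = ∑ i ∈ Finset.Ico a b, ξ (i + 1) • u (i + 1) := by
  rw [position, position, sum_Icc_one_eq, sum_Icc_one_eq,
    Finset.sum_Ico_eq_sub (fun i => ξ (i + 1) • u (i + 1)) hab]

lemma scatterTime_strictMono (hξ : ∀ i, 0 < ξ (i + 1)) : StrictMono (scatterTime ξ) :=
  strictMono_nat_of_lt_succ fun n => by rw [scatterTime_succ]; linarith [hξ n]

lemma lastScatter_eq (hξ : ∀ i, 0 < ξ (i + 1)) {c : ℕ} {t : ℝ} (h1 : scatterTime ξ c ≤ t)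
    (h2 : t < scatterTime ξ (c + 1)) : lastScatter ξ t = c := by
  have hm := scatterTime_strictMono hξ
  have : {n | scatterTime ξ n ≤ t} = Set.Iic c := by
    ext n
    constructor
    · intro hn
      have : scatterTime ξ n < scatterTime ξ (c + 1) := lt_of_le_of_lt hn h2
      exact Nat.lt_succ_iff.1 (hm.lt_iff_lt.1 this)
    · intro hn
      exact (hm.monotone hn).trans h1
  rw [lastScatter, this, csSup_Iic]

lemma flight_eq (hξ : ∀ i, 0 < ξ (i + 1)) (u : ℕ → Space) {c : ℕ} {t : ℝ}
    (h1 : scatterTime ξ c ≤ t) (h2 : t ≤ scatterTime ξ (c + 1)) :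
    flight u ξ t = position u ξ c + (t - scatterTime ξ c) • u (c + 1) := by
  rcases h2.lt_or_eq with h | rfl
  · rw [flight, lastScatter_eq hξ h1 h]
  · have h3 : scatterTime ξ (c + 1) < scatterTime ξ (c + 1 + 1) :=
      scatterTime_strictMono hξ (Nat.lt_succ_self _)
    rw [flight, lastScatter_eq hξ le_rfl h3, sub_self, zero_smul, add_zero, position_succ,
      scatterTime_succ, add_sub_cancel_left]

lemma exists_scatterTime_le {n : ℕ} {t : ℝ} (h0 : 0 < t) (h1 : t ≤ scatterTime ξ n) :
    ∃ c < n, scatterTime ξ c ≤ t ∧ t ≤ scatterTime ξ (c + 1) := by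
  induction n with
  | zero => rw [scatterTime_zero] at h1; linarith
  | succ n ih =>
    rcases le_total t (scatterTime ξ n) with h | h
    · obtain ⟨c, hc, h2⟩ := ih h
      exact ⟨c, by omega, h2⟩
    · exact ⟨n, by omega, h, h1⟩

/-- The flights in `Ico a b` (flight `i` runs between the scatterings `i` and `i + 1`), prolonged by
a part of flight `c`, bring the particle back to within `r` in each coordinate. -/
def FlightHit (r : ℝ) (u : ℕ → Space) (ξ : ℕ → ℝ) (a b c : ℕ) : Prop :=
  ∃ s, 0 ≤ s ∧ s ≤ ξ (c + 1) ∧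
    ∑ i ∈ Finset.Ico a b, ξ (i + 1) • u (i + 1) + s • u (c + 1) ∈ cube (2 * r)

lemma flightHit_of_shadowing (hξ : ∀ i, 0 < ξ (i + 1)) {c k : ℕ} (hck : c + 1 ≤ k) {t : ℝ}
    (hβ : β k ∈ cube r) (h1 : scatterTime ξ c ≤ t) (h2 : t ≤ scatterTime ξ (c + 1))
    (h : flight u ξ t - scatterer u ξ β k ∈ cube r) : FlightHit r u ξ (c + 1) k c := by
  refine ⟨scatterTime ξ (c + 1) - t, by linarith, by rw [scatterTime_succ]; linarith, fun j => ?_⟩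
  have e : ∑ i ∈ Finset.Ico (c + 1) k, ξ (i + 1) • u (i + 1) +
      (scatterTime ξ (c + 1) - t) • u (c + 1) =
      -(flight u ξ t - scatterer u ξ β k) - β k := by
    rw [← position_sub_position u ξ hck, flight_eq hξ u h1 h2, scatterer, position_succ,
      scatterTime_succ, add_sub_right_comm, add_smul, sub_smul, sub_smul]
    abel
  rw [e]
  have h3 := abs_le.1 (h j)
  have h4 := abs_le.1 (hβ j)
  simp only [PiLp.sub_apply, PiLp.neg_apply] at h3 ⊢
  exact abs_le.2 ⟨by linarith, by linarith⟩

lemma flightHit_of_recollision (hξ : ∀ i, 0 < ξ (i + 1)) {c k : ℕ} (hkc : k ≤ c) {t : ℝ}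
    (hβ : β k ∈ cube r) (h1 : scatterTime ξ c ≤ t) (h2 : t ≤ scatterTime ξ (c + 1))
    (h : flight u ξ t - scatterer u ξ β k ∈ cube r) : FlightHit r u ξ k c c := by
  refine ⟨t - scatterTime ξ c, by linarith, by rw [scatterTime_succ] at h2; linarith, fun j => ?_⟩
  have e : ∑ i ∈ Finset.Ico k c, ξ (i + 1) • u (i + 1) + (t - scatterTime ξ c) • u (c + 1) =
      (flight u ξ t - scatterer u ξ β k) + β k := by
    rw [← position_sub_position u ξ hkc, flight_eq hξ u h1 h2, scatterer]
    abel
  rw [e]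
  have h3 := abs_le.1 (h j)
  have h4 := abs_le.1 (hβ j)
  simp only [PiLp.sub_apply, PiLp.add_apply] at h3 ⊢
  exact abs_le.2 ⟨by linarith, by linarith⟩

/-- A recurrent path of flips: `x` starts from `0`, flips one coordinate at a time, and returns to
`0` infinitely often. -/
structure IsRecurrentPath (x : ℕ → Flips) : Prop where
  zero : x 0 = 0
  step : ∀ l, ∃ i, x (l + 1) = x l + single i
  returns : ∀ n, ∃ m, n < m ∧ x m = 0

lemma single_ne_zero (i : Fin 3) : single i ≠ 0 := by
  intro h
  have := congrFun h i
  simp [single] at this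

lemma IsRecurrentPath.excursionEnd_succ (h0 : ∀ i, v₀ i ≠ 0) {x : ℕ → Flips}
    (hx : IsRecurrentPath x) (hu : ∀ l, u (l + 1) = vel v₀ (x l)) {J : ℕ}
    (hJ : x (excursionEnd v₀ u J) = 0) :
    excursionEnd v₀ u J < excursionEnd v₀ u (J + 1) ∧ x (excursionEnd v₀ u (J + 1)) = 0 ∧
      ∀ l, excursionEnd v₀ u J < l → l < excursionEnd v₀ u (J + 1) → x l ≠ 0 := by
  set g := excursionEnd v₀ u J with hg
  have hiff : ∀ i, u (i + 1) = v₀ ↔ x i = 0 := by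
    intro i
    rw [hu]
    constructor
    · intro h
      exact vel_injective h0 (h.trans (vel_zero v₀).symm)
    · intro h; rw [h, vel_zero]
  have e : excursionEnd v₀ u (J + 1) = sInf {i | g + 1 < i ∧ u (i + 1) = v₀} := rfl
  have hne : {i | g + 1 < i ∧ u (i + 1) = v₀}.Nonempty := by
    obtain ⟨m, hm, hm0⟩ := hx.returns (g + 1)
    exact ⟨m, hm, (hiff m).2 hm0⟩
  have hmem := Nat.sInf_mem hne
  rw [← e] at hmem
  refine ⟨lt_trans (Nat.lt_succ_self g) hmem.1, (hiff _).1 hmem.2, fun l hl hl' h => ?_⟩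
  rcases (Nat.succ_le_of_lt hl).eq_or_lt with h1 | h1
  · obtain ⟨i, hi⟩ := hx.step g
    rw [hJ, zero_add] at hi
    rw [← h1] at h
    exact single_ne_zero i (hi.symm.trans h)
  · rw [e] at hl'
    exact Nat.notMem_of_lt_sInf hl' ⟨h1, (hiff l).2 h⟩

lemma IsRecurrentPath.excursionEnd (h0 : ∀ i, v₀ i ≠ 0) {x : ℕ → Flips}
    (hx : IsRecurrentPath x) (hu : ∀ l, u (l + 1) = vel v₀ (x l)) (J : ℕ) :
    x (WindTree.excursionEnd v₀ u J) = 0 ∧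
      occupation x 0 0 (WindTree.excursionEnd v₀ u J) = J := by
  induction J with
  | zero => exact ⟨hx.zero, by simp [WindTree.excursionEnd, occupation]⟩
  | succ J ih =>
    obtain ⟨h1, h2, h3⟩ := hx.excursionEnd_succ h0 hu ih.1
    refine ⟨h2, ?_⟩
    have ih2 := ih.2
    rw [occupation_eq_sum] at ih2 ⊢
    rw [← Finset.sum_Ico_consecutive _ (Nat.zero_le _) h1.le, ih2,
      Finset.sum_eq_sum_Ico_succ_bot h1, if_pos ih.1, Finset.sum_eq_zero, add_zero]
    intro l hl
    rw [Finset.mem_Ico] at hl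
    exact if_neg (h3 l (by omega) hl.2)

/-- Flight `c` immediately precedes or immediately follows the nonempty run of flights
`Ico a b`. -/
def Adjacent (a b c : ℕ) : Prop := a < b ∧ (c = b ∨ c + 1 = a)

lemma signHit_of_flightHit {x : ℕ → Flips} (h0 : ∀ i, v₀ i ≠ 0) {a b c : ℕ}
    (hc : u (c + 1) = vel v₀ (x c)) (hu : ∀ i ∈ Finset.Ico a b, u (i + 1) = vel v₀ (x i))
    (h : FlightHit r u ξ a b c) :
    SignHit x a b c ((∑ j, 1 / |v₀ j|) * r) (fun i => ξ (i + 1)) := by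
  obtain ⟨s, hs0, hs, hcube⟩ := h
  refine ⟨s, hs0, hs, fun j => ?_⟩
  have h1 := hcube j
  have e : (∑ i ∈ Finset.Ico a b, ξ (i + 1) • u (i + 1) + s • u (c + 1)) j =
      v₀ j * (∑ i ∈ Finset.Ico a b, ξ (i + 1) * sgn (x i) j + s * sgn (x c) j) := by
    rw [hc, Finset.sum_congr rfl fun i hi => by rw [hu i hi]]
    simp only [PiLp.add_apply, WithLp.ofLp_sum, Finset.sum_apply, PiLp.smul_apply, vel_apply,
      smul_eq_mul, mul_add, Finset.mul_sum]
    congr 1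
    · exact Finset.sum_congr rfl fun i _ => by ring
    · ring
  rw [e, abs_mul] at h1
  have hj : 0 < |v₀ j| := abs_pos.2 (h0 j)
  have hr : 0 ≤ r := by
    have := (mul_nonneg (abs_nonneg _) (abs_nonneg _)).trans h1
    linarith
  have h2 : 1 / |v₀ j| ≤ ∑ j, 1 / |v₀ j| :=
    Finset.single_le_sum (f := fun j => 1 / |v₀ j|) (fun _ _ => by positivity) (Finset.mem_univ j)
  refine le_trans ?_ (mul_le_mul_of_nonneg_right h2 hr)
  rw [div_mul_eq_mul_div, le_div_iff₀ hj]
  linarith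

end Pathwise

section HitBound
variable {p : Fin 3 → ℝ} {v₀ : Space} {r : ℝ} {S : Type u} [MeasurableSpace S] {P : Measure S}
  {u : ℕ → S → Space} {ξ : ℕ → S → ℝ} {β : ℕ → S → Space}

/-- A constant, depending on `v₀` only, in the bound for the probability of a hit. -/
def hitConst (v₀ : Space) : ℝ := 256 * (∑ j, 1 / |v₀ j|) * (1 + ∑ j, 1 / |v₀ j|) ^ 2

lemma hitConst_nonneg (v₀ : Space) : 0 ≤ hitConst v₀ := by
  unfold hitConst
  positivity

/-- The event `FlightHit` for a random flight. -/
def hitEvent (r : ℝ) (u : ℕ → S → Space) (ξ : ℕ → S → ℝ) (a b c : ℕ) : Set S :=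
  {ω | FlightHit r (fun n => u n ω) (fun n => ξ n ω) a b c}

lemma IsFlightData.measure_follow_inter_hitEvent_le [IsProbabilityMeasure P]
    (h : IsFlightData p v₀ r P u ξ β) (hp : IsWeight p) (h0 : ∀ i, v₀ i ≠ 0) (hr : 0 < r)
    (hr1 : r ≤ 1) {a b c : ℕ} (habc : Adjacent a b c) {w : List (Fin 3)} (hb : b ≤ w.length + 1)
    (hc : c ≤ w.length) :
    P (followEvent v₀ u w ∩ hitEvent r u ξ a b c) ≤ weight p w *
      (ENNReal.ofReal (hitConst v₀ * r) * ∑ k, decay (occupation (path w) (single k) a b)) := by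
  set D := ∑ j, 1 / |v₀ j| with hD
  have hD0 : 0 < D := by
    refine Finset.sum_pos (fun j _ => ?_) ⟨0, Finset.mem_univ 0⟩
    have := abs_pos.2 (h0 j)
    positivity
  have hsub : followEvent v₀ u w ∩ hitEvent r u ξ a b c ⊆
      followEvent v₀ u w ∩ {ω | SignHit (path w) a b c (D * r) (fun i => duration ξ i ω)} := by
    rintro ω ⟨hω, hh⟩
    refine ⟨hω, signHit_of_flightHit (u := fun n => u n ω) (ξ := fun n => ξ n ω) h0
      (hω c hc) (fun i hi => hω i ?_) hh⟩
    have := (Finset.mem_Ico.1 hi).2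
    omega
  refine (measure_mono hsub).trans ?_
  rw [h.measure_follow_inter_eq hp h0 hr]
  gcongr
  have hprob := h.isProbabilityMeasure_cond hp h0 hr w
  have hexp := h.isExpSequence_cond hp h0 hr w
  have hρ : 0 < D * r := by positivity
  have hbound : ∀ {d : ℕ}, d ∈ Finset.Ico a b → ∀ k, path w d = path w c + single k →
      P[|followEvent v₀ u w] {ω | SignHit (path w) a b c (D * r) (fun i => duration ξ i ω)} ≤
      ENNReal.ofReal (hitConst v₀ * r) * ∑ k, decay (occupation (path w) (single k) a b) := by
    intro d hd k hk
    have hcn : c ∉ Finset.Ico a b := by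
      rw [Finset.mem_Ico]
      rcases habc.2 with h1 | h1 <;> omega
    refine (measure_signHit_le hexp hcn hd k hk hρ).trans ?_
    refine mul_le_mul' (ENNReal.ofReal_le_ofReal ?_) le_rfl
    calc 256 * (D * r) * (1 + D * r) ^ 2 ≤ 256 * (D * r) * (1 + D) ^ 2 := by
          gcongr
          nlinarith
      _ = hitConst v₀ * r := by unfold hitConst; ring
  have hab := habc.1
  rcases habc.2 with h1 | h1
  · have hl : b - 1 < w.length := by omega
    refine hbound (d := b - 1) (Finset.mem_Ico.2 ⟨by omega, by omega⟩) w[b - 1] ?_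
    have := path_succ hl
    rw [Nat.sub_add_cancel (by omega)] at this
    rw [h1, this, add_assoc, flips_add_self, add_zero]
  · have hl : c < w.length := by omega
    refine hbound (d := a) (Finset.mem_Ico.2 ⟨le_rfl, hab⟩) w[c] ?_
    rw [← h1, path_succ hl]

end HitBound

/-! ### Excursions -/

/-- The total Green's function bound: a finite constant that dominates the potential estimate for
`decay` from any starting point. -/
def greenConst (φ : Flips → ℝ≥0∞) : ℝ≥0∞ := (∑ y, φ y) * decay 0 + φ 0 * ∑' k, decay (1 + k)

lemma le_greenConst (φ : Flips → ℝ≥0∞) (y : Flips) :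
    φ y * decay 0 + φ 0 * ∑' k, decay (1 + k) ≤ greenConst φ := by
  unfold greenConst
  gcongr
  exact Finset.single_le_sum (f := φ) (fun _ _ => zero_le) (Finset.mem_univ y)

lemma greenConst_ne_top {φ : Flips → ℝ≥0∞} (hφ : ∀ y, φ y ≠ ∞) : greenConst φ ≠ ∞ := by
  refine ENNReal.add_ne_top.2 ⟨ENNReal.mul_ne_top (ENNReal.sum_ne_top.2 fun y _ => hφ y)
    ENNReal.ofReal_ne_top, ENNReal.mul_ne_top (hφ 0) ?_⟩
  refine ne_top_of_le_ne_top tsum_decay_ne_top ?_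
  exact ENNReal.tsum_comp_le_tsum_of_injective (fun a b hab => by simpa using hab) decay

section Random
variable {p : Fin 3 → ℝ} {v₀ : Space} {r : ℝ} {S : Type u} [MeasurableSpace S] {P : Measure S}
  {u : ℕ → S → Space} {ξ : ℕ → S → ℝ} {β : ℕ → S → Space} {φ : Flips → ℝ≥0∞}

lemma IsFlightData.isExpSequence [IsProbabilityMeasure P]
    (h : IsFlightData p v₀ r P u ξ β) (hp : IsWeight p) (h0 : ∀ i, v₀ i ≠ 0) (hr : 0 < r) :
    IsExpSequence P (duration ξ) := by
  have h1 : P (followEvent v₀ u []) = 1 := by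
    rw [h.measure_follow h0 hr]; simp [weight]
  have e : P[|followEvent v₀ u []] = P := by
    ext H hH
    rw [cond_apply' hH, h1, inv_one, one_mul]
    have hae : ∀ᵐ ω ∂P, ω ∈ followEvent v₀ u [] :=
      (prob_compl_eq_zero_iff (h.measurableSet_followEvent [])).2 h1
    exact Measure.measure_inter_eq_of_ae hae
  rw [← e]
  exact h.isExpSequence_cond hp h0 hr []

lemma IsExpSequence.ae_pos [IsProbabilityMeasure P] {η : ℕ → S → ℝ} (h : IsExpSequence P η) :
    ∀ᵐ ω ∂P, ∀ i, 0 < η i ω := by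
  rw [ae_all_iff]
  intro i
  have h1 : P {ω | 0 ≤ η i ω} = 1 := by rw [h.measure_le i le_rfl]; simp
  have h2 : ∀ᵐ ω ∂P, 0 ≤ η i ω :=
    (prob_compl_eq_zero_iff (h.measurable i measurableSet_Ici)).2 h1
  have h3 := measure_blockSum_Icc_le h (I := {i}) (by simp) 0 0
  rw [zero_div, ENNReal.ofReal_zero, nonpos_iff_eq_zero,
    Measure.map_apply (measurable_blockSum h _) measurableSet_Icc] at h3
  filter_upwards [h2, measure_eq_zero_iff_ae_notMem.1 h3] with ω ha hb
  refine lt_of_le_of_ne ha fun he => hb ?_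
  simp [blockSum, ← he]

/-- Since the expected return time is finite, the velocity returns to `v₀` infinitely often. -/
lemma IsFlightData.ae_returns [IsProbabilityMeasure P]
    (h : IsFlightData p v₀ r P u ξ β) (hp : IsWeight p) (h0 : ∀ i, v₀ i ≠ 0) (hr : 0 < r)
    (hφ : ∀ y, φ y ≠ ∞) (hφ' : IsHittingBound (letter p) φ) :
    ∀ᵐ ω ∂P, ∀ n, ∃ m, n < m ∧ u (m + 1) ω = v₀ := by
  rw [ae_all_iff]
  intro n
  set B : Set S := {ω | ¬ ∃ m, n < m ∧ u (m + 1) ω = v₀} with hB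
  change P B = 0
  have hM : ∀ M, P B ≤ wordSum (letter p) n (fun a => wordSum (letter p) M
      (fun b => if visits (pos a) b = 0 then 1 else 0)) := by
    intro M
    have e : wordSum (letter p) n (fun a => wordSum (letter p) M
        (fun b => if visits (pos a) b = 0 then 1 else 0)) = wordSum (letter p) (n + M)
        (fun w => if visits (pos (w.take n)) (w.drop n) = 0 then 1 else 0) := by
      rw [wordSum_append]
      refine wordSum_congr fun a ha => wordSum_congr fun b _ => ?_
      rw [List.take_left' ha, List.drop_left' ha]
    rw [e]
    refine h.measure_le_wordSum hp h0 hr (n + M) B _ fun w hw => ?_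
    rw [← h.measure_follow h0 hr w]
    split_ifs with hv
    · rw [mul_one]; exact measure_mono Set.inter_subset_left
    · rw [mul_zero, nonpos_iff_eq_zero]
      have : followEvent v₀ u w ∩ B = ∅ := by
        ext ω
        simp only [Set.mem_inter_iff, Set.mem_empty_iff_false, iff_false, not_and]
        intro hω hωB
        apply hv
        rw [visits_eq_sum, Finset.sum_eq_zero]
        intro l hl
        rw [Finset.mem_range, List.length_drop, hw] at hl
        refine if_neg fun hz => hωB ⟨n + l + 1, by omega, ?_⟩
        rw [hω (n + l + 1) (by omega), path, add_assoc, List.take_add, pos_append, hz, vel_zero]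
      rw [this, measure_empty]
  have hsum : ∑' _M : ℕ, P B ≤ ∑ y, φ y := by
    calc ∑' _M : ℕ, P B ≤ ∑' M, wordSum (letter p) n (fun a => wordSum (letter p) M
          (fun b => if visits (pos a) b = 0 then 1 else 0)) := ENNReal.tsum_le_tsum hM
      _ = wordSum (letter p) n (fun a => ∑' M, wordSum (letter p) M
          (fun b => if visits (pos a) b = 0 then 1 else 0)) := (wordSum_tsum n _).symm
      _ ≤ wordSum (letter p) n (fun _ => ∑ y, φ y) := by
          refine wordSum_mono fun a _ =>
            (tsum_wordSum_visits_eq_zero_le (sum_letter hp) hφ' (pos a)).trans ?_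
          exact Finset.single_le_sum (f := φ) (fun _ _ => zero_le) (Finset.mem_univ _)
      _ = _ := wordSum_const (sum_letter hp) n _
  by_contra hne
  rw [ENNReal.tsum_const_eq_top_of_ne_zero hne, top_le_iff] at hsum
  exact ENNReal.sum_ne_top.2 (fun y _ => hφ y) hsum

lemma IsFlightData.ae_exists_path [IsProbabilityMeasure P]
    (h : IsFlightData p v₀ r P u ξ β) (hp : IsWeight p) (h0 : ∀ i, v₀ i ≠ 0) (hr : 0 < r) :
    ∀ᵐ ω ∂P, ∃ x : ℕ → Flips, IsRecurrentPath x ∧ ∀ l, u (l + 1) ω = vel v₀ (x l) := by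
  obtain ⟨φ, hφ, hφ'⟩ := exists_isHittingBound hp
  filter_upwards [h.ae_exists_follow hp h0 hr, h.ae_returns hp h0 hr hφ hφ'] with ω h1 h2
  choose w hw hf using h1
  have hu : ∀ l, u (l + 1) ω = vel v₀ (path (w l) l) := fun l => hf l l (hw l).ge
  have heq : ∀ n l, l ≤ n → path (w n) l = path (w l) l := by
    intro n l hl
    apply vel_injective h0
    rw [← hu, ← hf n l (hl.trans (hw n).ge)]
  refine ⟨fun l => path (w l) l, ⟨rfl, fun l => ?_, fun n => ?_⟩, hu⟩
  · have hl : l < (w (l + 1)).length := by rw [hw]; exact Nat.lt_succ_self l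
    refine ⟨(w (l + 1))[l], ?_⟩
    rw [path_succ hl, heq (l + 1) l (Nat.le_succ l)]
  · obtain ⟨m, hm, hm'⟩ := h2 n
    refine ⟨m, hm, vel_injective h0 ?_⟩
    rw [← hu, hm', vel_zero]

/-- Along the word `w`, exactly `J` excursions make up the first `n + d` flights, and the next
excursion lasts longer than `m` flights. -/
def IsPastWord (J n d m : ℕ) (w : List (Fin 3)) : Prop :=
  path w (n + d) = 0 ∧ occupation (path w) 0 0 (n + d) = J ∧
    ∀ l, n + d < l → l ≤ n + d + m → path w l ≠ 0

/-- The flights in `Ico d b` and the adjacent flight `c` produce a hit, where `n` of the flights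
belong to the first `J` excursions and the flights after these belong to the next one. The last
condition is stated for every word that the velocities follow; there is at most one of each
length. -/
def pastHitEvent (v₀ : Space) (r : ℝ) (u : ℕ → S → Space) (ξ : ℕ → S → ℝ) (J n d m b c : ℕ) :
    Set S :=
  {ω | Adjacent d b c ∧ ω ∈ hitEvent r u ξ d b c ∧
    ∀ w, w.length = n + d + m → ω ∈ followEvent v₀ u w → IsPastWord J n d m w}

lemma IsFlightData.measure_pastHitEvent_le [IsProbabilityMeasure P]
    (h : IsFlightData p v₀ r P u ξ β) (hp : IsWeight p) (h0 : ∀ i, v₀ i ≠ 0) (hr : 0 < r)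
    (hr1 : r ≤ 1) (J n d m : ℕ) {b c : ℕ} (hb : n + d ≤ b) (hb' : b ≤ n + d + m + 1)
    (hc : c ≤ n + d + m) :
    P (pastHitEvent v₀ r u ξ J n d m b c) ≤ ENNReal.ofReal (hitConst v₀ * r) *
      ((∑ k, wordSum (letter p) (n + d) (fun a =>
        if pos a = 0 ∧ occupation (path a) 0 0 (n + d) = J then
          decay (occupation (path a) (single k) d (n + d)) else 0)) *
      wordSum (letter p) m (fun b => if visits 0 b = 0 then 1 else 0)) := by
  classical
  have hword : P (pastHitEvent v₀ r u ξ J n d m b c) ≤ wordSum (letter p) (n + d + m)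
      (fun w => if IsPastWord J n d m w then ENNReal.ofReal (hitConst v₀ * r) *
        ∑ k, decay (occupation (path w) (single k) d b) else 0) := by
    refine h.measure_le_wordSum hp h0 hr _ _ _ fun w hw => ?_
    split_ifs with hgood
    · by_cases had : Adjacent d b c
      · refine le_trans (measure_mono ?_) (h.measure_follow_inter_hitEvent_le hp h0 hr hr1 had
          (by omega) (by omega))
        rintro ω ⟨hω, -, hh, -⟩
        exact ⟨hω, hh⟩
      · have : followEvent v₀ u w ∩ pastHitEvent v₀ r u ξ J n d m b c = ∅ := by
          ext ω
          simp only [Set.mem_inter_iff, Set.mem_empty_iff_false, iff_false, not_and]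
          exact fun _ hω => had hω.1
        simp [this]
    · have : followEvent v₀ u w ∩ pastHitEvent v₀ r u ξ J n d m b c = ∅ := by
        ext ω
        simp only [Set.mem_inter_iff, Set.mem_empty_iff_false, iff_false, not_and]
        exact fun hω hω' => hgood (hω'.2.2 w hw hω)
      simp [this]
  refine hword.trans ?_
  rw [wordSum_append, ← wordSum_sum, mul_comm (wordSum (letter p) (n + d) _), ← wordSum_const_mul,
    ← wordSum_const_mul]
  refine wordSum_mono fun a ha => ?_
  rw [mul_comm (wordSum (letter p) m _), ← mul_assoc, ← wordSum_const_mul]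
  refine wordSum_mono fun b' hb' => ?_
  have hcongr : ∀ y e, occupation (path (a ++ b')) y e (n + d) = occupation (path a) y e (n + d) :=
    fun y e => occupation_congr y fun i hi =>
      path_append (by rw [ha]; exact (Finset.mem_Ico.1 hi).2.le)
  by_cases hgood : IsPastWord J n d m (a ++ b')
  swap
  · rw [if_neg hgood]; exact zero_le
  obtain ⟨g1, g2, g3⟩ := id hgood
  rw [hcongr] at g2
  rw [path_append ha.ge, path, List.take_of_length_le ha.le] at g1
  have hv : visits 0 b' = 0 := by
    rw [visits_eq_sum, Finset.sum_eq_zero]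
    intro l hl
    rw [Finset.mem_range, hb'] at hl
    refine if_neg fun hz => g3 (n + d + (l + 1)) (by omega) (by omega) ?_
    rw [path, List.take_append, List.take_of_length_le (by omega), ha, pos_append, g1,
      show n + d + (l + 1) - (n + d) = l + 1 by omega]
    exact hz
  rw [if_pos hgood, if_pos hv, mul_one]
  simp only [g1, g2, and_self, if_true]
  gcongr with k
  apply decay_antitone
  rw [← hcongr]
  exact occupation_mono _ _ le_rfl hb

/-- Summing over the past, read backwards from the beginning of the excursion, and over the
flights of the excursion. -/
lemma IsFlightData.measure_iUnion_pastHitEvent_le [IsProbabilityMeasure P]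
    (h : IsFlightData p v₀ r P u ξ β) (hp : IsWeight p) (h0 : ∀ i, v₀ i ≠ 0) (hr : 0 < r)
    (hr1 : r ≤ 1) (hφ' : IsHittingBound (letter p) φ) (J : ℕ) (b c : ℕ → ℕ → ℕ → ℕ)
    (hb : ∀ n d m, n + d ≤ b n d m) (hb' : ∀ n d m, b n d m ≤ n + d + m + 1)
    (hc : ∀ n d m, c n d m ≤ n + d + m) :
    P (⋃ n, ⋃ d, ⋃ m, pastHitEvent v₀ r u ξ J n d m (b n d m) (c n d m)) ≤
      ENNReal.ofReal (hitConst v₀ * r) * (3 * greenConst φ * φ 0) := by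
  let past : Fin 3 → ℕ → ℕ → ℝ≥0∞ := fun k n d => wordSum (letter p) (n + d) (fun a =>
        if pos a = 0 ∧ occupation (path a) 0 0 (n + d) = J then
          decay (occupation (path a) (single k) d (n + d)) else 0)
  let fut : ℕ → ℝ≥0∞ := fun m => wordSum (letter p) m (fun b => if visits 0 b = 0 then 1 else 0)
  calc P (⋃ n, ⋃ d, ⋃ m, pastHitEvent v₀ r u ξ J n d m (b n d m) (c n d m))
      ≤ ∑' n, ∑' d, ∑' m, P (pastHitEvent v₀ r u ξ J n d m (b n d m) (c n d m)) :=
        (measure_iUnion_le _).trans (ENNReal.tsum_le_tsum fun n => (measure_iUnion_le _).trans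
          (ENNReal.tsum_le_tsum fun d => measure_iUnion_le _))
    _ ≤ ∑' n, ∑' d, ∑' m, ENNReal.ofReal (hitConst v₀ * r) * ((∑ k, past k n d) * fut m) :=
        ENNReal.tsum_le_tsum fun n => ENNReal.tsum_le_tsum fun d => ENNReal.tsum_le_tsum fun m =>
          h.measure_pastHitEvent_le hp h0 hr hr1 J n d m (hb n d m) (hb' n d m) (hc n d m)
    _ = ENNReal.ofReal (hitConst v₀ * r) * ((∑ k, ∑' n, ∑' d, past k n d) * ∑' m, fut m) := by
        simp only [ENNReal.tsum_mul_left, ENNReal.tsum_mul_right]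
        simp only [Summable.tsum_finsetSum (fun _ _ => ENNReal.summable)]
    _ ≤ ENNReal.ofReal (hitConst v₀ * r) * ((∑ _k : Fin 3, greenConst φ) * φ 0) := by
        gcongr with k
        · exact (tsum_wordSum_past_le (sum_letter hp) hφ' decay (single k) J).trans
            (le_greenConst φ _)
        · exact tsum_wordSum_visits_eq_zero_le (sum_letter hp) hφ' 0
    _ = _ := by simp

lemma isPastWord_of_follow {S : Type*} {u : ℕ → S → Space} (h0 : ∀ i, v₀ i ≠ 0) {ω : S}
    {x : ℕ → Flips} (hx : IsRecurrentPath x) (hu : ∀ l, u (l + 1) ω = vel v₀ (x l)) {J n d m : ℕ}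
    (hg : excursionEnd v₀ (fun n => u n ω) J = n + d)
    (hm : n + d + m < excursionEnd v₀ (fun n => u n ω) (J + 1)) {w : List (Fin 3)}
    (hw : w.length = n + d + m) (hf : ω ∈ followEvent v₀ u w) : IsPastWord J n d m w := by
  have hpath : ∀ l ≤ n + d + m, path w l = x l := by
    intro l hl
    apply vel_injective h0
    rw [← hu, hf l (by omega)]
  obtain ⟨g1, g2⟩ := hx.excursionEnd (u := fun n => u n ω) h0 hu J
  obtain ⟨-, -, g3⟩ := hx.excursionEnd_succ (u := fun n => u n ω) h0 hu g1
  rw [hg] at g1 g2 g3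
  refine ⟨by rw [hpath _ (by omega), g1], ?_, fun l hl hl' => ?_⟩
  · rw [← g2]
    refine occupation_congr 0 fun i hi => hpath i ?_
    have := (Finset.mem_Ico.1 hi).2
    omega
  · rw [hpath l hl']
    exact g3 l hl (by omega)

lemma IsFlightData.measure_interShadowing_le [IsProbabilityMeasure P]
    (h : IsFlightData p v₀ r P u ξ β) (hp : IsWeight p) (h0 : ∀ i, v₀ i ≠ 0) (hr : 0 < r)
    (hr1 : r ≤ 1) (hφ' : IsHittingBound (letter p) φ) (J : ℕ) :
    P {ω | InterShadowing r v₀ (fun n => u n ω) (fun n => ξ n ω) (fun n => β n ω) (J + 1)} ≤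
      ENNReal.ofReal (hitConst v₀ * r) * (3 * greenConst φ * φ 0) := by
  refine le_trans (measure_mono_ae ?_) (h.measure_iUnion_pastHitEvent_le hp h0 hr hr1 hφ' J
    (fun n d m => n + d + m + 1) (fun n d m => d - 1) (fun n d m => by omega) (fun n d m => le_rfl)
    (fun n d m => by omega))
  filter_upwards [h.ae_exists_path hp h0 hr, h.ae_mem_cube hp h0 hr,
    (h.isExpSequence hp h0 hr).ae_pos] with ω hpath hβ hξ hω
  obtain ⟨x, hx, hu⟩ := hpath
  obtain ⟨t, k, ht0, htg, hgk, hk, hmem⟩ := hω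
  rw [Nat.add_sub_cancel] at htg hgk
  obtain ⟨c, hc, hc1, hc2⟩ := exists_scatterTime_le ht0 htg.le
  have hc' : c + 1 ≤ k := by omega
  have hhit := flightHit_of_shadowing (u := fun n => u n ω) (ξ := fun n => ξ n ω)
    (β := fun n => β n ω) hξ hc' (hβ k) hc1 hc2 hmem
  -- The run consists of `n` past flights, `c + 1, …, n + c`, and the `m + 1` flights up to `k - 1`.
  obtain ⟨n, hn⟩ := Nat.exists_eq_add_of_le' (Nat.succ_le_of_lt hc)
  obtain ⟨m, hm⟩ := Nat.exists_eq_add_of_lt hgk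
  rw [hn] at hm
  refine Set.mem_iUnion.2 ⟨n, Set.mem_iUnion.2 ⟨c + 1, Set.mem_iUnion.2 ⟨m, ⟨?_, ?_⟩, ?_, ?_⟩⟩⟩
  · omega
  · exact Or.inr (by omega)
  · rw [← Nat.succ_eq_add_one c, ← hm, Nat.succ_sub_one]; exact hhit
  · intro w hw hf
    exact isPastWord_of_follow h0 hx hu hn (by omega) hw hf

lemma IsFlightData.measure_interRecollision_le [IsProbabilityMeasure P]
    (h : IsFlightData p v₀ r P u ξ β) (hp : IsWeight p) (h0 : ∀ i, v₀ i ≠ 0) (hr : 0 < r)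
    (hr1 : r ≤ 1) (hφ' : IsHittingBound (letter p) φ) (J : ℕ) :
    P {ω | InterRecollision r v₀ (fun n => u n ω) (fun n => ξ n ω) (fun n => β n ω) (J + 1)} ≤
      ENNReal.ofReal (hitConst v₀ * r) * (3 * greenConst φ * φ 0) := by
  refine le_trans (measure_mono_ae ?_) (h.measure_iUnion_pastHitEvent_le hp h0 hr hr1 hφ' J
    (fun n d m => n + d + m) (fun n d m => n + d + m) (fun n d m => by omega)
    (fun n d m => by omega) (fun n d m => le_rfl))
  filter_upwards [h.ae_exists_path hp h0 hr, h.ae_mem_cube hp h0 hr,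
    (h.isExpSequence hp h0 hr).ae_pos] with ω hpath hβ hξ hω
  obtain ⟨x, hx, hu⟩ := hpath
  obtain ⟨t, k, hkg, htg, ht, hmem⟩ := hω
  rw [Nat.add_sub_cancel] at htg hkg
  have hmono := scatterTime_strictMono (ξ := fun n => ξ n ω) hξ
  have ht0 : 0 < t := by
    refine lt_of_le_of_lt ?_ htg
    rw [← scatterTime_zero (fun n => ξ n ω)]
    exact hmono.monotone (Nat.zero_le _)
  obtain ⟨c, hc, hc1, hc2⟩ := exists_scatterTime_le ht0 ht.le
  have hgc : excursionEnd v₀ (fun n => u n ω) J ≤ c :=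
    Nat.lt_succ_iff.1 (hmono.lt_iff_lt.1 (htg.trans_le hc2))
  have hmem' : flight (fun n => u n ω) (fun n => ξ n ω) t -
      scatterer (fun n => u n ω) (fun n => ξ n ω) (fun n => β n ω) k ∈ cube r := by
    intro i
    have := hmem i
    rwa [← neg_sub, PiLp.neg_apply, abs_neg] at this
  have hhit := flightHit_of_recollision (u := fun n => u n ω) (ξ := fun n => ξ n ω)
    (β := fun n => β n ω) hξ (by omega : k ≤ c) (hβ k) hc1 hc2 hmem'
  -- The run consists of `n` past flights, `k, …, n + k - 1`, and the `m` flights up to `c - 1`.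
  obtain ⟨n, hn⟩ := Nat.exists_eq_add_of_le' hkg.le
  obtain ⟨m, hm⟩ := Nat.exists_eq_add_of_le hgc
  rw [hn] at hm
  refine Set.mem_iUnion.2 ⟨n, Set.mem_iUnion.2 ⟨k, Set.mem_iUnion.2 ⟨m, ⟨?_, ?_⟩, ?_, ?_⟩⟩⟩
  · omega
  · exact Or.inl rfl
  · rw [← hm]; exact hhit
  · intro w hw hf
    exact isPastWord_of_follow h0 hx hu hn (by omega) hw hf

end Random

/-! ### Mismatches up to a fixed time -/

lemma visits_le_occupation_append (y : Flips) (A B : List (Fin 3)) :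
    visits (pos A + y) B ≤ occupation (path (A ++ B)) y A.length (A.length + B.length + 1) := by
  refine le_trans (le_of_eq ?_)
    (occupation_mono _ _ (Nat.le_succ A.length) (le_refl (A.length + B.length + 1)))
  rw [occupation_eq_sum, Finset.sum_Ico_eq_sum_range, visits_eq_sum,
    show A.length + B.length + 1 - A.length.succ = B.length by omega]
  refine Finset.sum_congr rfl fun l _ => ?_
  have e : path (A ++ B) (A.length.succ + l) = pos A + pos (B.take (l + 1)) := by
    rw [path, List.take_append, List.take_of_length_le (by omega), pos_append,
      show A.length.succ + l - A.length = l + 1 by omega]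
  rw [e]
  simp only [add_right_comm (pos A) y, flips_add_eq_zero, eq_comm (a := y)]

section Random
variable {p : Fin 3 → ℝ} {v₀ : Space} {r : ℝ} {S : Type u} [MeasurableSpace S] {P : Measure S}
  {u : ℕ → S → Space} {ξ : ℕ → S → ℝ} {β : ℕ → S → Space} {φ : Flips → ℝ≥0∞}

lemma tsum_wordSum_decay_le (hp : IsWeight p) (hφ' : IsHittingBound (letter p) φ) (y : Flips)
    (a : ℕ) :
    ∑' n, wordSum (letter p) (a + n + 1) (fun w => decay (occupation (path w) y a (a + n + 1))) ≤
      greenConst φ := by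
  have key : ∀ n, wordSum (letter p) (a + n + 1)
      (fun w => decay (occupation (path w) y a (a + n + 1))) ≤
      wordSum (letter p) a (fun A =>
        wordSum (letter p) n (fun B => decay (visits (pos A + y) B))) := by
    intro n
    rw [wordSum_append (a + n) 1, wordSum_append a n]
    refine wordSum_mono fun A hA => wordSum_mono fun B hB => ?_
    rw [← wordSum_const (sum_letter hp) 1 (decay (visits (pos A + y) B))]
    refine wordSum_mono fun C _ => decay_antitone ?_
    have := visits_le_occupation_append y A B
    rw [hA, hB] at this
    refine this.trans (le_of_eq ?_)
    refine occupation_congr y fun i hi => (path_append ?_).symm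
    have := (Finset.mem_Ico.1 hi).2
    rw [List.length_append]
    omega
  refine (ENNReal.tsum_le_tsum key).trans ?_
  rw [← wordSum_tsum, ← wordSum_const (sum_letter hp) a (greenConst φ)]
  exact wordSum_mono fun A _ =>
    (tsum_wordSum_visits_le (sum_letter hp) hφ' decay _).trans (le_greenConst φ _)

/-- The probability that any run of flights beginning with flight `a` produces a hit. -/
lemma IsFlightData.measure_iUnion_hitEvent_le [IsProbabilityMeasure P]
    (h : IsFlightData p v₀ r P u ξ β) (hp : IsWeight p) (h0 : ∀ i, v₀ i ≠ 0) (hr : 0 < r)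
    (hr1 : r ≤ 1) (hφ' : IsHittingBound (letter p) φ) (a : ℕ) (c : ℕ → ℕ)
    (hc : ∀ n, Adjacent a (a + n + 1) (c n)) :
    P (⋃ n, hitEvent r u ξ a (a + n + 1) (c n)) ≤
      ENNReal.ofReal (hitConst v₀ * r) * (3 * greenConst φ) := by
  have key : ∀ n, P (hitEvent r u ξ a (a + n + 1) (c n)) ≤ ENNReal.ofReal (hitConst v₀ * r) *
      ∑ k, wordSum (letter p) (a + n + 1)
        (fun w => decay (occupation (path w) (single k) a (a + n + 1))) := by
    intro n
    rw [← wordSum_sum, ← wordSum_const_mul]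
    refine h.measure_le_wordSum hp h0 hr _ _ _ fun w hw => ?_
    refine h.measure_follow_inter_hitEvent_le hp h0 hr hr1 (hc n) (by omega) ?_
    rcases (hc n).2 with h1 | h1 <;> omega
  calc P (⋃ n, hitEvent r u ξ a (a + n + 1) (c n))
      ≤ ∑' n, P (hitEvent r u ξ a (a + n + 1) (c n)) := measure_iUnion_le _
    _ ≤ _ := ENNReal.tsum_le_tsum key
    _ = ENNReal.ofReal (hitConst v₀ * r) * ∑ k, ∑' n, wordSum (letter p) (a + n + 1)
        (fun w => decay (occupation (path w) (single k) a (a + n + 1))) := by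
        rw [ENNReal.tsum_mul_left, Summable.tsum_finsetSum (fun _ _ => ENNReal.summable)]
    _ ≤ ENNReal.ofReal (hitConst v₀ * r) * ∑ _k : Fin 3, greenConst φ := by
        gcongr with k
        exact tsum_wordSum_decay_le hp hφ' (single k) a
    _ = _ := by simp

/-- Mismatches up to time `T`: at most `N` flights take place up to time `T`, unless `τ_N ≤ T`,
and each of them begins a run producing a hit with probability `O(r)`. -/
lemma IsFlightData.measure_mismatchUpTo_le [IsProbabilityMeasure P]
    (h : IsFlightData p v₀ r P u ξ β) (hp : IsWeight p) (h0 : ∀ i, v₀ i ≠ 0) (hr : 0 < r)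
    (hr1 : r ≤ 1) (hφ' : IsHittingBound (letter p) φ) (T : ℝ) (N : ℕ) :
    P {ω | MismatchUpTo r (fun n => u n ω) (fun n => ξ n ω) (fun n => β n ω) T} ≤
      2 * N * (ENNReal.ofReal (hitConst v₀ * r) * (3 * greenConst φ)) +
        P {ω | blockSum (duration ξ) (Finset.range N) ω ≤ T} := by
  set ε := ENNReal.ofReal (hitConst v₀ * r) * (3 * greenConst φ) with hε
  let before : ℕ → Set S := fun c => ⋃ n, hitEvent r u ξ (c + 1) (c + 1 + n + 1) c
  let after : ℕ → Set S := fun k => ⋃ n, hitEvent r u ξ k (k + n + 1) (k + n + 1)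
  have hb : ∀ c, P (before c) ≤ ε := fun c =>
    h.measure_iUnion_hitEvent_le hp h0 hr hr1 hφ' (c + 1) (fun _ => c)
      (fun n => ⟨by omega, Or.inr rfl⟩)
  have ha : ∀ k, P (after k) ≤ ε := fun k =>
    h.measure_iUnion_hitEvent_le hp h0 hr hr1 hφ' k (fun n => k + n + 1)
      (fun n => ⟨by omega, Or.inl rfl⟩)
  have hsub : P {ω | MismatchUpTo r (fun n => u n ω) (fun n => ξ n ω) (fun n => β n ω) T} ≤
      P ((⋃ c ∈ Finset.range N, (before c ∪ after c)) ∪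
        {ω | blockSum (duration ξ) (Finset.range N) ω ≤ T}) := by
    apply measure_mono_ae
    filter_upwards [h.ae_mem_cube hp h0 hr, (h.isExpSequence hp h0 hr).ae_pos] with ω hβ hξ hω
    by_cases hT : blockSum (duration ξ) (Finset.range N) ω ≤ T
    · exact Or.inr hT
    left
    have hT' : T < scatterTime (fun n => ξ n ω) N := by
      rw [scatterTime, sum_Icc_one_eq]; exact not_le.1 hT
    obtain ⟨t, k, ht0, htT, hkT, hor, hmem⟩ := hω
    have hmono := scatterTime_strictMono (ξ := fun n => ξ n ω) hξ
    have hkN : k < N := hmono.lt_iff_lt.1 (hkT.trans_lt hT')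
    rcases hor with h1 | h1
    · obtain ⟨c, hc, hc1, hc2⟩ := exists_scatterTime_le ht0 h1
      have hhit := flightHit_of_shadowing (u := fun n => u n ω) (ξ := fun n => ξ n ω)
        (β := fun n => β n ω) hξ (by omega : c + 1 ≤ k) (hβ k) hc1 hc2 hmem
      obtain ⟨n, rfl⟩ : ∃ n, k = c + 1 + n + 1 := ⟨k - c - 2, by omega⟩
      exact Set.mem_biUnion (x := c) (Finset.mem_coe.2 (Finset.mem_range.2 (by omega)))
        (Or.inl (Set.mem_iUnion.2 ⟨n, hhit⟩))
    · obtain ⟨c, hc, hc1, hc2⟩ := exists_scatterTime_le ht0 (htT.trans hT'.le)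
      rcases lt_or_ge k c with hkc | hkc
      · have hhit := flightHit_of_recollision (u := fun n => u n ω) (ξ := fun n => ξ n ω)
          (β := fun n => β n ω) hξ hkc.le (hβ k) hc1 hc2 hmem
        obtain ⟨n, rfl⟩ : ∃ n, c = k + n + 1 := ⟨c - k - 1, by omega⟩
        exact Set.mem_biUnion (x := k) (Finset.mem_coe.2 (Finset.mem_range.2 hkN))
          (Or.inr (Set.mem_iUnion.2 ⟨n, hhit⟩))
      · -- The only remaining possibility is `t = τ_(k+1)`, which also belongs to flight `k + 1`.
        have hck : c = k := le_antisymm hkc (Nat.lt_succ_iff.1 (Nat.succ_lt_succ_iff.1 (by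
          have := hmono.le_iff_le.1 (h1.trans hc2); omega)))
        subst hck
        have hte : t = scatterTime (fun n => ξ n ω) (c + 1) := le_antisymm hc2 h1
        have hhit := flightHit_of_recollision (u := fun n => u n ω) (ξ := fun n => ξ n ω)
          (β := fun n => β n ω) hξ (Nat.le_succ c) (hβ c) hte.ge
          (hte.le.trans (hmono (Nat.lt_succ_self (c + 1))).le) hmem
        exact Set.mem_biUnion (x := c) (Finset.mem_coe.2 (Finset.mem_range.2 hkN))
          (Or.inr (Set.mem_iUnion.2 ⟨0, hhit⟩))
  refine hsub.trans ((measure_union_le _ _).trans ?_)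
  gcongr
  calc P (⋃ c ∈ Finset.range N, (before c ∪ after c))
      ≤ ∑ c ∈ Finset.range N, P (before c ∪ after c) := measure_biUnion_finset_le _ _
    _ ≤ ∑ _c ∈ Finset.range N, (ε + ε) :=
        Finset.sum_le_sum fun c _ => (measure_union_le _ _).trans (add_le_add (hb c) (ha c))
    _ = 2 * N * ε := by
        rw [Finset.sum_const, Finset.card_range, nsmul_eq_mul]; ring

end Random

/-- The bound of `IsExpSequence.measure_blockSum_le_le` for `⌈4 T⌉ + m + 1` flights. -/
lemma pow_ceil_mul_exp_le (T : ℝ) (m : ℕ) :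
    ((1 : ℝ) / 4) ^ (⌈4 * T⌉₊ + m) * Real.exp (4 * T) ≤ (1 / 4) ^ m := by
  have h1 : Real.exp (4 * T) ≤ 4 ^ ⌈4 * T⌉₊ := by
    calc Real.exp (4 * T) ≤ Real.exp ⌈4 * T⌉₊ := Real.exp_le_exp.2 (Nat.le_ceil _)
      _ = Real.exp 1 ^ ⌈4 * T⌉₊ := by rw [← Real.exp_nat_mul, mul_one]
      _ ≤ 4 ^ ⌈4 * T⌉₊ := by
          gcongr
          linarith [Real.exp_one_lt_d9]
  calc ((1 : ℝ) / 4) ^ (⌈4 * T⌉₊ + m) * Real.exp (4 * T)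
      ≤ ((1 : ℝ) / 4) ^ (⌈4 * T⌉₊ + m) * 4 ^ ⌈4 * T⌉₊ := by gcongr
    _ = (1 / 4) ^ m := by
        rw [pow_add, mul_right_comm, ← mul_pow]
        norm_num

end WindTree

end

open WindTree in
theorem mainTheorem5 (p : Fin 3 → ℝ) (hp : IsWeight p) (v₀ : Space) (hv₀ : v₀ ∈ velocities p) :
    (∃ C : ℝ, 0 < C ∧ ∀ r : ℝ, 0 < r →
      ∀ (S : Type u) [MeasurableSpace S] (P : Measure S) [IsProbabilityMeasure P]
        (u : ℕ → S → Space) (ξ : ℕ → S → ℝ) (β : ℕ → S → Space),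
        IsFlightData p v₀ r P u ξ β →
        ∀ j : ℕ, 1 ≤ j →
          P {ω | InterShadowing r v₀ (fun n => u n ω) (fun n => ξ n ω) (fun n => β n ω) j}
              ≤ ENNReal.ofReal (C * r) ∧
          P {ω | InterRecollision r v₀ (fun n => u n ω) (fun n => ξ n ω) (fun n => β n ω) j}
              ≤ ENNReal.ofReal (C * r)) ∧
    (∀ T : ℝ → ℝ, Tendsto (fun r => r * T r) (𝓝[>] 0) (𝓝 0) →
      ∀ ε : ℝ, 0 < ε → ∃ r₀ : ℝ, 0 < r₀ ∧ ∀ r : ℝ, 0 < r → r < r₀ →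
        ∀ (S : Type u) [MeasurableSpace S] (P : Measure S) [IsProbabilityMeasure P]
          (u : ℕ → S → Space) (ξ : ℕ → S → ℝ) (β : ℕ → S → Space),
          IsFlightData p v₀ r P u ξ β →
          P {ω | MismatchUpTo r (fun n => u n ω) (fun n => ξ n ω) (fun n => β n ω) (T r)}
            ≤ ENNReal.ofReal ε) := by
  have h0 := ne_zero_of_mem_velocities hp hv₀
  obtain ⟨φ, hφ, hφ'⟩ := exists_isHittingBound hp
  have hG := greenConst_ne_top hφ
  have hK := hitConst_nonneg v₀
  constructor
  · set X : ℝ≥0∞ := 3 * greenConst φ * φ 0 with hX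
    have hXtop : X ≠ ∞ := ENNReal.mul_ne_top (ENNReal.mul_ne_top (by norm_num) hG) (hφ 0)
    refine ⟨hitConst v₀ * X.toReal + 1, by positivity, ?_⟩
    intro r hr S _ P _ u ξ β h j hj
    obtain ⟨J, rfl⟩ : ∃ J, j = J + 1 := ⟨j - 1, by omega⟩
    rcases le_total r 1 with hr1 | hr1
    · have hle : ENNReal.ofReal (hitConst v₀ * r) * X ≤
          ENNReal.ofReal ((hitConst v₀ * X.toReal + 1) * r) := by
        rw [← ENNReal.ofReal_toReal hXtop, ← ENNReal.ofReal_mul (by positivity),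
          ENNReal.toReal_ofReal ENNReal.toReal_nonneg]
        apply ENNReal.ofReal_le_ofReal
        linarith
      exact ⟨(h.measure_interShadowing_le hp h0 hr hr1 hφ' J).trans hle,
        (h.measure_interRecollision_le hp h0 hr hr1 hφ' J).trans hle⟩
    · have hle : (1 : ℝ≥0∞) ≤ ENNReal.ofReal ((hitConst v₀ * X.toReal + 1) * r) := by
        rw [ENNReal.one_le_ofReal]
        have : 0 ≤ hitConst v₀ * X.toReal := by positivity
        nlinarith
      exact ⟨prob_le_one.trans hle, prob_le_one.trans hle⟩
  · intro T hT ε hε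
    set L : ℝ := 2 * (hitConst v₀ * (3 * (greenConst φ).toReal)) with hL
    have hL0 : 0 ≤ L := by positivity
    obtain ⟨m, hm⟩ := exists_pow_lt_of_lt_one (half_pos hε) (by norm_num : (1 : ℝ) / 4 < 1)
    have hr0 : Tendsto (fun r : ℝ => r) (𝓝[>] 0) (𝓝 0) :=
      tendsto_nhdsWithin_of_tendsto_nhds tendsto_id
    have hlim : Tendsto (fun r => L * (4 * (r * T r) + (m + 2) * r)) (𝓝[>] 0) (𝓝 0) := by
      have := ((hT.const_mul 4).add (hr0.const_mul ((m : ℝ) + 2))).const_mul L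
      simpa using this
    have hev := (hlim.eventually (gt_mem_nhds (half_pos hε))).and
      (mem_nhdsWithin_of_mem_nhds (Iio_mem_nhds (zero_lt_one (α := ℝ))))
    obtain ⟨r₀, hr₀, hsub⟩ := mem_nhdsGT_iff_exists_Ioo_subset.1 hev
    refine ⟨r₀, hr₀, ?_⟩
    intro r hr hrr S _ P _ u ξ β h
    obtain ⟨hsmall, hr1⟩ := hsub ⟨hr, hrr⟩
    have hr1 : r ≤ 1 := le_of_lt hr1
    rcases le_or_gt (T r) 0 with hT0 | hT0
    · have : {ω | MismatchUpTo r (fun n => u n ω) (fun n => ξ n ω) (fun n => β n ω) (T r)} = ∅ := by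
        ext ω
        simp only [Set.mem_empty_iff_false, iff_false]
        rintro ⟨t, k, ht0, htT, -⟩
        linarith
      rw [this, measure_empty]
      exact zero_le
    set N : ℕ := ⌈4 * T r⌉₊ + m + 1 with hN
    refine (h.measure_mismatchUpTo_le hp h0 hr hr1 hφ' (T r) N).trans ?_
    have h1 : P {ω | blockSum (duration ξ) (Finset.range N) ω ≤ T r} ≤ ENNReal.ofReal (ε / 2) := by
      refine ((h.isExpSequence hp h0 hr).measure_blockSum_le_le (I := Finset.range N)
        (n := ⌈4 * T r⌉₊ + m) (by simp [hN]) (T r)).trans (ENNReal.ofReal_le_ofReal ?_)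
      exact (pow_ceil_mul_exp_le (T r) m).trans hm.le
    have h2 : 2 * (N : ℝ≥0∞) * (ENNReal.ofReal (hitConst v₀ * r) * (3 * greenConst φ)) ≤
        ENNReal.ofReal (ε / 2) := by
      have e : 2 * (N : ℝ≥0∞) * (ENNReal.ofReal (hitConst v₀ * r) * (3 * greenConst φ)) =
          ENNReal.ofReal (2 * N * (hitConst v₀ * r * (3 * (greenConst φ).toReal))) := by
        rw [ENNReal.ofReal_mul (p := 2 * (N : ℝ)) (by positivity),
          ENNReal.ofReal_mul (p := 2) (by positivity),
          ENNReal.ofReal_mul (p := hitConst v₀ * r) (by positivity),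
          ENNReal.ofReal_mul (p := 3) (by positivity), ENNReal.ofReal_toReal hG,
          ENNReal.ofReal_natCast]
        simp
      rw [e]
      apply ENNReal.ofReal_le_ofReal
      have hceil : (N : ℝ) ≤ 4 * T r + (m + 2) := by
        have := (Nat.ceil_lt_add_one (by positivity : 0 ≤ 4 * T r)).le
        rw [hN]; push_cast; linarith
      calc 2 * (N : ℝ) * (hitConst v₀ * r * (3 * (greenConst φ).toReal)) = L * r * N := by
            rw [hL]; ring
        _ ≤ L * r * (4 * T r + (m + 2)) := by gcongr
        _ = L * (4 * (r * T r) + (m + 2) * r) := by ring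
        _ ≤ ε / 2 := le_of_lt hsmall
    calc _ ≤ ENNReal.ofReal (ε / 2) + ENNReal.ofReal (ε / 2) := add_le_add h2 h1
      _ = ENNReal.ofReal ε := by
        rw [← ENNReal.ofReal_add (by positivity) (by positivity), add_halves]
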